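/- All graphs are finite, simple and undirected. A graph is arc-transitive if every ordered pair of adjacent vertices can be mapped to any other ordered pair of adjacent vertices by an automorphism of the graph. For $k\ge 2$, the $k$-dimensional Weisfeiler-Leman algorithm ($k$-WL) colors the $k$-tuples of vertices of a graph with vertex set $V$. Initially, $\bar u=(u_1,\dots,u_k)\in V^k$ gets a color $\alpha_0(\bar u)$ that encodes which of its entries are equal and which are adjacent; in round $r+1$ it gets the multiset $$\alpha_{r+1}(\bar u)=\{\!\!\{(\alpha_r(\bar u^w_1),\dots,\alpha_r(\bar u^w_k)) : w\in V\}\!\!\},$$ where $\bar u_i^w$ arises from $\bar u$ by replacing its $i$-th entry with $w$. $1$-WL is classical color refinement: all vertices initially have the same color, and in each round the new color of a vertex consists of its old color and the multiset of the old colors of its neighbors. Two graphs are indistinguishable by $k$-WL if, after every number of rounds, the multiset of colors is the same for both of them. **Part 1.** For every positive square number $n$ divisible by $16$ there are graphs $G$ and $H$ with $n$ vertices such that $G$ is arc-transitive, $H$ is not arc-transitive, and $G$ and $H$ are indistinguishable by $k$-WL for every integer $k\ge1$ with $k\le 0.05\sqrt n$. **Part 2.** For every integer $n=16p$, where $p$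 is a prime with $p\equiv 1\pmod 3$, there are graphs $G$ and $H$ with $n$ vertices such that $G$ is arc-transitive, $H$ is not arc-transitive, and $G$ and $H$ are indistinguishable by $k$-WL for every integer $k\ge1$ with $k\le 0.06\sqrt n$. -/

import Mathlib

namespace WLArc

/-- A graph is arc-transitive if every ordered pair of adjacent vertices can be taken to any
other ordered pair of adjacent vertices by an automorphism. -/
def ArcTransitive {V : Type*} (G : SimpleGraph V) : Prop :=
  ∀ ⦃u v u' v' : V⦄, G.Adj u v → G.Adj u' v' → ∃ φ : G ≃g G, φ u = u' ∧ φ v = v'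

/-- Initial colors of `k`-tuples: an equality type together with an adjacency pattern. -/
abbrev InitColor (k : ℕ) : Type :=
  (Fin k → Fin k → Prop) × (Fin k → Fin k → Prop)

/-- The colors that the `k`-dimensional Weisfeiler-Leman algorithm uses in round `r`. They do not
depend on the input graph, so that colors arising from different graphs can be compared. -/
def Color (k : ℕ) : ℕ → Type
  | 0 => InitColor k
  | r + 1 => Multiset (Fin k → Color k r)

/-- The initial color of `u`: its equality type and the ordered isomorphism type of the subgraph
induced by its entries. -/
def initColor {V : Type*} (G : SimpleGraph V) (k : ℕ) (u : Fin k → V) : InitColor k :=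
  (fun i j => u i = u j, fun i j => G.Adj (u i) (u j))

/-- The coloring of `V ^ k` after `r` rounds of the `k`-dimensional Weisfeiler-Leman algorithm
(`2 ≤ k`). The new color of `u` is the multiset, over all vertices `w`, of the `k`-tuples whose
`i`-th entry is the old color of the tuple obtained from `u` by replacing its `i`-th entry
with `w`. -/
def color {V : Type*} [Fintype V] (G : SimpleGraph V) (k : ℕ) :
    (r : ℕ) → (Fin k → V) → Color k r
  | 0 => initColor G k
  | r + 1 => fun u =>
      (Finset.univ : Finset V).val.map fun w => fun i => color G k r (Function.update u i w)

/-- The colors that one-dimensional color refinement uses in round `r`. -/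
def Color₁ : ℕ → Type
  | 0 => Unit
  | r + 1 => Color₁ r × Multiset (Color₁ r)

open Classical in
/-- The vertex coloring after `r` rounds of classical color (degree) refinement: the new color of
a vertex consists of its old color and the multiset of the old colors of its neighbors. -/
noncomputable def color₁ {V : Type*} [Fintype V] (G : SimpleGraph V) : (r : ℕ) → V → Color₁ r
  | 0 => fun _ => ()
  | r + 1 => fun v =>
      (color₁ G r v, (Finset.univ.filter fun w => G.Adj v w).val.map (color₁ G r))

/-- `G` and `H` are indistinguishable by the `k`-dimensional Weisfeiler-Leman algorithm: run in
parallel on both graphs, it produces the same multiset of colors after every number of rounds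
(in particular after both colorings have stabilized). For `k = 1` the algorithm is classical
color refinement. -/
def WLIndistinguishable {V W : Type*} [Fintype V] [Fintype W] (k : ℕ)
    (G : SimpleGraph V) (H : SimpleGraph W) : Prop :=
  if k = 1 then
    ∀ r : ℕ, (Finset.univ : Finset V).val.map (color₁ G r) =
      (Finset.univ : Finset W).val.map (color₁ H r)
  else
    ∀ r : ℕ, (Finset.univ : Finset (Fin k → V)).val.map (color G k r) =
      (Finset.univ : Finset (Fin k → W)).val.map (color H k r)

end WLArc

/-!
The witnesses are graphs in the style of Cai, Fürer and Immerman. Over a connected base graph in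
which all vertices have the same degree, every vertex `v` is replaced by the even subsets of the set
of edges at `v`, and two such subsets over adjacent vertices are joined if they agree on the common
edge; if this edge is twisted, they are joined if they disagree. The base graph consists of two
copies of a graph `P`. In `G` there is no twist, and in `H` one edge of the second copy is twisted.
For the first part, `P` is the toroidal grid of side `m = √n / 4`, which gives `2 · m² · 2³ = n`
vertices, and for the second part it is a honeycomb with `2p` vertices on a torus, which gives
`2 · 2p · 2² = n` vertices.

*Indistinguishability* (`PortGraph.wlIndistinguishable_cfi`). Adding an even vector in each fiber
is an isomorphism that changes the twists. In this way a twist can be moved along a path of the base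
graph, where only the fibers over the path are affected (`PortGraph.Reach.twistEquiv`). The vertices
of a `k`-tuple, together with one further vertex, lie over at most `k + 1` vertices of the base
graph. If one component of the complement of each set of this size can be selected such that these
choices are compatible (`PortGraph.Haven`), then the twist can be kept away from the tuple in
every round. In the grid, the component is the one with all intact rows and columns
(`Torus.haven`). In the honeycomb, it is the one with more than half of one class of the bipartition
(`Honeycomb.haven`). It exists since any two vertices of this class are joined by a walk with at
most `√p` double steps that depends, up to translation, only on their difference, so that a small
set meets few of these walks (`Honeycomb.exists_majority`). The bound on the length comes from
reduction modulo an Eisenstein integer of norm `p` (`Honeycomb.exists_small`). Color refinement, the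
case `k = 1`, cannot tell apart regular graphs of the same degree.

*Arc-transitivity of `G`* (`PortGraph.arcTransitive_cfi`). The automorphisms of the base graph lift,
and translation by an element of the cycle space of the base graph is an automorphism. The faces
next to an edge provide enough elements of the cycle space to move all arcs over this edge to each
other (`PortGraph.FlexibleAt`).

*No arc-transitivity of `H`* (`PortGraph.not_arcTransitive_cfi_double`). An automorphism that takes
an arc from the first copy to the second preserves the number of homomorphisms from `P` with a
prescribed image of one vertex. But there are more of them to the untwisted copy: over each map
from `P` to itself, the homomorphisms to either copy are the solutions of a system of linear equations
over `ℤ/2`, homogeneous for the untwisted copy. Over the identity, the system for the twisted copy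
is not solvable, by parity (`PortGraph.no_section`).
-/

namespace WLArc

open Finset

/-! ### Isomorphism invariance of the Weisfeiler-Leman colorings -/

lemma map_univ_val_congr {α β γ : Type*} [Fintype α] [Fintype β] {f : α → γ} {g : β → γ}
    (e : α ≃ β) (h : ∀ x, f x = g (e x)) :
    (univ : Finset α).val.map f = (univ : Finset β).val.map g := by
  rw [← Multiset.map_univ_val_equiv e, Multiset.map_map]
  exact Multiset.map_congr rfl fun x _ => h x

lemma map_filter_val_congr {α β γ : Type*} [Fintype α] [Fintype β] {f : α → γ} {g : β → γ}
    {p : α → Prop} {q : β → Prop} [DecidablePred p] [DecidablePred q]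
    (e : α ≃ β) (h : ∀ x, f x = g (e x)) (hpq : ∀ x, p x ↔ q (e x)) :
    (univ.filter p).val.map f = (univ.filter q).val.map g := by
  rw [filter_val, filter_val, ← Multiset.map_univ_val_equiv e, Multiset.filter_map,
    Multiset.map_map]
  have : Multiset.filter (q ∘ e) (univ : Finset α).val = Multiset.filter p univ.val :=
    Multiset.filter_congr fun x _ => (hpq x).symm
  rw [this]
  exact Multiset.map_congr rfl fun x _ => h x

lemma color_iso {V W : Type*} [Fintype V] [Fintype W] {G : SimpleGraph V} {H : SimpleGraph W}
    (φ : G ≃g H) (k r : ℕ) (u : Fin k → V) : color G k r u = color H k r (φ ∘ u) := by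
  induction r generalizing u with
  | zero =>
    simp only [color, initColor, Function.comp]
    refine Prod.ext ?_ ?_ <;> funext i j
    · simp
    · exact propext φ.map_adj_iff.symm
  | succ r ih =>
    refine map_univ_val_congr φ.toEquiv fun w => ?_
    funext i
    rw [ih, Function.comp_update]
    rfl

lemma color₁_iso {V W : Type*} [Fintype V] [Fintype W] {G : SimpleGraph V} {H : SimpleGraph W}
    (φ : G ≃g H) (r : ℕ) (v : V) : color₁ G r v = color₁ H r (φ v) := by
  induction r generalizing v with
  | zero => rfl
  | succ r ih =>
    classical
    exact Prod.ext (ih v) (map_filter_val_congr φ.toEquiv ih fun w => φ.map_adj_iff.symm)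

lemma WLIndistinguishable.congr {V W V' W' : Type*} [Fintype V] [Fintype W] [Fintype V']
    [Fintype W'] {k : ℕ} {G : SimpleGraph V} {H : SimpleGraph W} {G' : SimpleGraph V'}
    {H' : SimpleGraph W'} (φ : G ≃g G') (ψ : H ≃g H') (h : WLIndistinguishable k G H) :
    WLIndistinguishable k G' H' := by
  unfold WLIndistinguishable at h ⊢
  split_ifs at h ⊢ with hk
  · intro r
    rw [← map_univ_val_congr φ.toEquiv (color₁_iso φ r),
      ← map_univ_val_congr ψ.toEquiv (color₁_iso ψ r)]
    exact h r
  · intro r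
    rw [← map_univ_val_congr ((Equiv.refl (Fin k)).arrowCongr φ.toEquiv) (color_iso φ k r),
      ← map_univ_val_congr ((Equiv.refl (Fin k)).arrowCongr ψ.toEquiv) (color_iso ψ k r)]
    exact h r

lemma ArcTransitive.congr {V W : Type*} {G : SimpleGraph V} {H : SimpleGraph W}
    (φ : G ≃g H) (h : ArcTransitive G) : ArcTransitive H := by
  intro u v u' v' huv hu'v'
  obtain ⟨σ, h1, h2⟩ := h (φ.symm.map_adj_iff.2 huv) (φ.symm.map_adj_iff.2 hu'v')
  exact ⟨(φ.symm.trans σ).trans φ, by simp [h1], by simp [h2]⟩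

/-- Arc-transitivity and indistinguishability only depend on the isomorphism types, so witnesses
may be given on any vertex set of the right size. -/
lemma exists_on_fin {V : Type*} [Fintype V] {n : ℕ} (hn : Fintype.card V = n) {K : ℕ → Prop}
    (G H : SimpleGraph V) (hG : ArcTransitive G) (hH : ¬ ArcTransitive H)
    (hGH : ∀ k, K k → WLIndistinguishable k G H) :
    ∃ G H : SimpleGraph (Fin n), ArcTransitive G ∧ ¬ ArcTransitive H ∧
      ∀ k, K k → WLIndistinguishable k G H := by
  let e : V ≃ Fin n := Fintype.equivFinOfCardEq hn
  exact ⟨G.map e.toEmbedding, H.map e.toEmbedding, hG.congr (SimpleGraph.Iso.map e G),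
    fun h => hH (h.congr (SimpleGraph.Iso.map e H).symm),
    fun k hk => (hGH k hk).congr (SimpleGraph.Iso.map e G) (SimpleGraph.Iso.map e H)⟩

/-! ### Even vectors -/

/-- The vectors over `ℤ/2` with coordinate sum `0`, that is, the subsets of `D` of even size. -/
def EvenVec (D : Type*) [Fintype D] : AddSubgroup (D → ZMod 2) where
  carrier := {a | ∑ i, a i = 0}
  add_mem' {a b} ha hb := by
    simp only [Set.mem_ofPred_eq, Pi.add_apply, sum_add_distrib] at *
    rw [ha, hb, add_zero]
  zero_mem' := by simp
  neg_mem' {a} ha := by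
    simp only [Set.mem_ofPred_eq, Pi.neg_apply, sum_neg_distrib] at *
    rw [ha, neg_zero]

namespace EvenVec

variable {D : Type*} [Fintype D]

instance : CoeFun (EvenVec D) (fun _ => D → ZMod 2) := ⟨Subtype.val⟩

noncomputable instance : Fintype (EvenVec D) := Fintype.ofFinite _

lemma sum_eq (a : EvenVec D) : ∑ i, a i = 0 := a.2

@[simp] lemma coe_add (a b : EvenVec D) (i : D) : (a + b) i = a i + b i := rfl

@[simp] lemma coe_zero (i : D) : (0 : EvenVec D) i = 0 := rfl

lemma add_self (a : EvenVec D) : a + a = 0 :=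
  Subtype.ext (funext fun i => CharTwo.add_self_eq_zero (a i))

lemma add_add_cancel (a b : EvenVec D) : a + b + b = a := by
  rw [add_assoc, add_self, add_zero]

/-- The even vector with ones exactly at `i` and `j` (and `0` if `i = j`). -/
def pair [DecidableEq D] (i j : D) : EvenVec D :=
  ⟨Pi.single i 1 + Pi.single j 1, by
    change ∑ l, (Pi.single i 1 + Pi.single j 1 : D → ZMod 2) l = 0
    simp [sum_add_distrib, CharTwo.add_self_eq_zero]⟩

/-- The action of coordinate permutations on even vectors. -/
def permute (ρ : D ≃ D) : EvenVec D ≃ EvenVec D where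
  toFun a := ⟨a ∘ ρ.symm, by
    change ∑ l, a (ρ.symm l) = 0
    rw [Equiv.sum_comp ρ.symm a, sum_eq]⟩
  invFun a := ⟨a ∘ ρ, by
    change ∑ l, a (ρ l) = 0
    rw [Equiv.sum_comp ρ a, sum_eq]⟩
  left_inv a := Subtype.ext (by funext i; simp)
  right_inv a := Subtype.ext (by funext i; simp)

@[simp] lemma permute_apply (ρ : D ≃ D) (a : EvenVec D) (i : D) : permute ρ a (ρ i) = a i := by
  simp [permute]

lemma card_fin_succ (d : ℕ) : Fintype.card (EvenVec (Fin (d + 1))) = 2 ^ d := by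
  have e : EvenVec (Fin (d + 1)) ≃ (Fin d → ZMod 2) :=
    { toFun := fun a i => a i.succ
      invFun := fun b => ⟨Fin.cons (∑ i, b i) b, by
        change ∑ l, (Fin.cons (∑ i, b i) b : Fin (d + 1) → ZMod 2) l = 0
        simp [Fin.sum_univ_succ, CharTwo.add_self_eq_zero]⟩
      left_inv := fun a => by
        have h := sum_eq a
        rw [Fin.sum_univ_succ] at h
        refine Subtype.ext (funext fun i => ?_)
        refine Fin.cases ?_ (fun i => ?_) i
        · simpa using (CharTwo.add_eq_zero.1 h).symm
        · simp
      right_inv := fun b => by funext i; simp }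
  rw [Fintype.card_congr e]
  simp

end EvenVec

/-! ### Port-numbered graphs and their Cai-Fürer-Immerman graphs -/

/-- A simple graph on `V` in which the neighbors of every vertex are numbered by the set `D` of
ports, so that all degrees are `|D|`. It is given by its darts: the pair `(v, i)` is the edge at
port `i` of `v`, seen from `v`, and `rev` takes it to the same edge, seen from its other end. -/
structure PortGraph (V D : Type*) where
  /-- Reversal of darts. -/
  rev : V × D → V × D
  rev_rev : ∀ d, rev (rev d) = d
  loopless : ∀ d, (rev d).1 ≠ d.1
  simple : ∀ v i j, (rev (v, i)).1 = (rev (v, j)).1 → i = j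

namespace PortGraph

variable {V D : Type*}

lemma rev_symm (P : PortGraph V D) {d e : V × D} (h : P.rev d = e) : P.rev e = d := by
  rw [← h, P.rev_rev]

/-- The underlying simple graph. -/
def graph (P : PortGraph V D) : SimpleGraph V where
  Adj v w := ∃ i, (P.rev (v, i)).1 = w
  symm := ⟨fun v w ⟨i, h⟩ => ⟨(P.rev (v, i)).2, by subst h; rw [Prod.mk.eta, P.rev_rev]⟩⟩
  loopless := ⟨fun v ⟨i, h⟩ => P.loopless (v, i) h⟩

/-- `v` and `w` are joined by a path outside of `S`. -/
def Reach (P : PortGraph V D) (S : Set V) : V → V → Prop :=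
  Relation.ReflTransGen fun v w => v ∉ S ∧ w ∉ S ∧ ∃ i, (P.rev (v, i)).1 = w

lemma Reach.symm {P : PortGraph V D} {S : Set V} {v w : V} (h : P.Reach S v w) :
    P.Reach S w v := by
  induction h with
  | refl => exact .refl
  | tail _ hxy ih =>
    obtain ⟨hx, hy, i, rfl⟩ := hxy
    exact .head ⟨hy, hx, (P.rev (_, i)).2, by rw [Prod.mk.eta, P.rev_rev]⟩ ih

lemma Reach.mono {P : PortGraph V D} {S T : Set V} (hST : S ⊆ T) {v w : V}
    (h : P.Reach T v w) : P.Reach S v w :=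
  Relation.ReflTransGen.mono (fun _ _ h => ⟨fun h' => h.1 (hST h'), fun h' => h.2.1 (hST h'),
    h.2.2⟩) _ _ h

/-- The Cai-Fürer-Immerman graph of `P`. Each vertex `v` is replaced by the set of pairs `(v, a)`
with `a` an even vector on the ports, and an edge from port `i` of `v` to port `j` of `w` joins
`(v, a)` to `(w, b)` if `a i = b j` or, in case that the edge is twisted, if `a i ≠ b j`. The edge
counts as twisted if `τ` takes different values on its two darts, so each `τ` is permitted. -/
def cfi [Fintype D] (P : PortGraph V D) (τ : V × D → ZMod 2) :
    SimpleGraph (V × EvenVec D) where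
  Adj x y := ∃ i j, P.rev (x.1, i) = (y.1, j) ∧ x.2 i + y.2 j = τ (x.1, i) + τ (y.1, j)
  symm := ⟨fun x y ⟨i, j, h, h'⟩ => ⟨j, i, P.rev_symm h, by rw [add_comm, h', add_comm]⟩⟩
  loopless := ⟨fun x ⟨i, j, h, _⟩ => P.loopless (x.1, i) (by rw [h])⟩

variable [Fintype D]

/-! ### Moving twists -/

/-- Translation by `t v` on the fiber over each vertex `v`. -/
def gaugeEquiv (t : V → EvenVec D) : V × EvenVec D ≃ V × EvenVec D where
  toFun x := (x.1, x.2 + t x.1)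
  invFun x := (x.1, x.2 + t x.1)
  left_inv _ := Prod.ext rfl (EvenVec.add_add_cancel _ _)
  right_inv _ := Prod.ext rfl (EvenVec.add_add_cancel _ _)

/-- Translation by `t` turns the twisting by `τ` into the twisting by `τ'`. -/
def Shifts (P : PortGraph V D) (t : V → EvenVec D) (τ τ' : V × D → ZMod 2) : Prop :=
  ∀ d, τ' d + τ' (P.rev d) =
    τ d + τ (P.rev d) + (t d.1 d.2 + t (P.rev d).1 (P.rev d).2)

/-- Translating the fibers is an isomorphism between the graphs for different twistings. -/
def gaugeIso (P : PortGraph V D) {t : V → EvenVec D} {τ τ' : V × D → ZMod 2}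
    (h : P.Shifts t τ τ') : P.cfi τ ≃g P.cfi τ' where
  toEquiv := gaugeEquiv t
  map_rel_iff' := by
    intro x y
    refine exists_congr fun i => exists_congr fun j => and_congr_right fun hij => ?_
    have h' := h (x.1, i)
    rw [show P.rev (x.1, i) = (y.1, j) from hij] at h'
    simp only [gaugeEquiv, Equiv.coe_fn_mk, EvenVec.coe_add]
    rw [h', add_add_add_comm]
    exact add_left_inj _

lemma gaugeIso_apply (P : PortGraph V D) {t : V → EvenVec D} {τ τ' : V × D → ZMod 2}
    (h : P.Shifts t τ τ') (x : V × EvenVec D) : P.gaugeIso h x = (x.1, x.2 + t x.1) := rfl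

/-- The twisting `τ` can be turned into `τ'` by a translation that fixes all fibers over `S`. -/
def TwistEquiv (P : PortGraph V D) (S : Set V) (τ τ' : V × D → ZMod 2) : Prop :=
  ∃ t : V → EvenVec D, (∀ v ∈ S, t v = 0) ∧ P.Shifts t τ τ'

lemma TwistEquiv.trans {P : PortGraph V D} {S : Set V} {τ τ' τ'' : V × D → ZMod 2}
    (h : P.TwistEquiv S τ τ') (h' : P.TwistEquiv S τ' τ'') : P.TwistEquiv S τ τ'' := by
  obtain ⟨t, h1, h2⟩ := h
  obtain ⟨t', h1', h2'⟩ := h'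
  refine ⟨t + t', fun v hv => by simp [h1 v hv, h1' v hv], fun d => ?_⟩
  rw [h2' d, h2 d]
  simp only [Pi.add_apply, EvenVec.coe_add]
  ring

section Single

variable [DecidableEq V] [DecidableEq D]

/-- A twist can be moved between two edges at the same vertex. -/
lemma twistEquiv_same_vertex (P : PortGraph V D) {S : Set V} {v : V} (hv : v ∉ S) (i j : D) :
    P.TwistEquiv S (Pi.single (v, i) 1) (Pi.single (v, j) 1) := by
  have key : ∀ d : V × D, (Pi.single v (EvenVec.pair i j) : V → EvenVec D) d.1 d.2 =
      (Pi.single (v, i) 1 : V × D → ZMod 2) d + (Pi.single (v, j) 1 : V × D → ZMod 2) d := by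
    rintro ⟨w, l⟩
    by_cases hw : w = v
    · subst hw
      simp [EvenVec.pair, Pi.single_apply]
    · simp [hw]
  refine ⟨Pi.single v (EvenVec.pair i j), fun w hw => ?_, fun d => ?_⟩
  · rw [Pi.single_eq_of_ne]
    rintro rfl
    exact hv hw
  · rw [key, key]
    generalize (Pi.single (v, i) 1 : V × D → ZMod 2) d = a
    generalize (Pi.single (v, j) 1 : V × D → ZMod 2) d = b
    generalize (Pi.single (v, i) 1 : V × D → ZMod 2) (P.rev d) = a'
    generalize (Pi.single (v, j) 1 : V × D → ZMod 2) (P.rev d) = b'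
    revert a b a' b'
    decide

lemma twistEquiv_rev (P : PortGraph V D) (S : Set V) (e : V × D) :
    P.TwistEquiv S (Pi.single e 1) (Pi.single (P.rev e) 1) := by
  refine ⟨0, fun _ _ => rfl, fun d => ?_⟩
  have h1 : (P.rev d = e) ↔ d = P.rev e :=
    ⟨fun h => (P.rev_symm h).symm, fun h => P.rev_symm h.symm⟩
  have h2 : (P.rev d = P.rev e) ↔ d = e :=
    ⟨fun h => by rw [← P.rev_rev d, h, P.rev_rev], fun h => by rw [h]⟩
  simp only [Pi.single_apply, h1, h2, Pi.zero_apply, EvenVec.coe_zero]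
  ring

end Single

/-- A twist can be moved along a path, and only the fibers over the path are affected. -/
lemma Reach.twistEquiv [DecidableEq V] [DecidableEq D] {P : PortGraph V D} {S : Set V} {v w : V}
    (h : P.Reach S v w) (hv : v ∉ S) (i j : D) :
    P.TwistEquiv S (Pi.single (v, i) 1) (Pi.single (w, j) 1) := by
  induction h generalizing j with
  | refl => exact P.twistEquiv_same_vertex hv i j
  | @tail x y _ hxy ih =>
    obtain ⟨_, hy, l, rfl⟩ := hxy
    exact ((ih l).trans (P.twistEquiv_rev S (x, l))).trans (P.twistEquiv_same_vertex hy _ j)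

/-! ### Indistinguishability -/

/-- A rule that selects, for every set `S` of at most `s` vertices, a set of vertices that lies in
one connected component of the complement of `S` and does not grow when `S` does. -/
structure Haven (P : PortGraph V D) (s : ℕ) where
  /-- The selected set. -/
  side : Finset V → Set V
  nonempty : ∀ S, S.card ≤ s → (side S).Nonempty
  notMem : ∀ S, ∀ v ∈ side S, v ∉ S
  anti : ∀ S T, S ⊆ T → side T ⊆ side S
  reach : ∀ S, S.card ≤ s → ∀ v ∈ side S, ∀ w ∈ side S, P.Reach S v w

section WL

variable [Fintype V] [DecidableEq V] [DecidableEq D]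

/-- A tuple cannot tell an untwisted graph from one with a single twist, provided that the twist
is on the side that the haven assigns to the vertices of the tuple: whichever further vertex `w`
is looked at, the twist can be moved away from `w` without affecting the tuple. -/
lemma color_cfi_eq {P : PortGraph V D} {k : ℕ} (h : P.Haven (k + 1)) (r : ℕ)
    (u : Fin k → V × EvenVec D) (v : V) (i : D)
    (hv : v ∈ h.side (univ.image fun l => (u l).1)) :
    color (P.cfi 0) k r u = color (P.cfi (Pi.single (v, i) 1)) k r u := by
  induction r generalizing u v i with
  | zero =>
    refine Prod.ext rfl ?_
    funext a b
    have h0 : ∀ l m, (Pi.single (v, i) 1 : V × D → ZMod 2) ((u l).1, m) = 0 := by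
      intro l m
      rw [Pi.single_eq_of_ne]
      intro hl
      exact h.notMem _ _ hv (mem_image.2 ⟨l, mem_univ _, congrArg Prod.fst hl⟩)
    refine propext (exists_congr fun l => exists_congr fun m => and_congr_right fun _ => ?_)
    rw [h0, h0]
    rfl
  | succ r ih =>
    set S : Finset V := univ.image fun l => (u l).1 with hS
    have hcardS : S.card ≤ k := card_image_le.trans (by simp)
    have hcard : ∀ y, (insert y S).card ≤ k + 1 := fun y =>
      (card_insert_le _ _).trans (Nat.succ_le_succ hcardS)
    choose z hz using fun y => h.nonempty (insert y S) (hcard y)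
    have hmem : ∀ y, z y ∈ h.side S := fun y => h.anti _ _ (subset_insert y S) (hz y)
    have hmove : ∀ y, P.TwistEquiv S (Pi.single (z y, i) 1) (Pi.single (v, i) 1) := fun y =>
      (h.reach S (hcardS.trans (Nat.le_succ k)) _ (hmem y) _ hv).twistEquiv
        (h.notMem _ _ (hmem y)) i i
    choose t ht hshift using hmove
    refine map_univ_val_congr (gaugeEquiv fun y => t y y) fun w => ?_
    funext j
    have hsub : univ.image (fun l => (Function.update u j w l).1) ⊆ insert w.1 S := by
      intro x hx
      obtain ⟨l, -, rfl⟩ := mem_image.1 hx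
      rcases eq_or_ne l j with rfl | hl
      · simp
      · rw [Function.update_of_ne hl]
        exact mem_insert_of_mem (mem_image_of_mem (fun l => (u l).1) (mem_univ l))
    rw [ih (Function.update u j w) (z w.1) i (h.anti _ _ hsub (hz w.1)),
      color_iso (P.gaugeIso (hshift w.1)), Function.comp_update]
    have hfix : P.gaugeIso (hshift w.1) ∘ u = u := by
      funext l
      have : t w.1 (u l).1 = 0 :=
        ht w.1 _ (mem_coe.2 (mem_image_of_mem (fun l => (u l).1) (mem_univ l)))
      simp [gaugeIso_apply, this]
    rw [hfix]
    rfl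

lemma map_color_cfi_eq {P : PortGraph V D} {k : ℕ} (h : P.Haven (k + 1)) (r : ℕ)
    (v : V) (i : D) (hv : ∀ z ∈ h.side ∅, P.Reach ∅ z v) :
    (univ : Finset (Fin k → V × EvenVec D)).val.map (color (P.cfi 0) k r) =
      (univ : Finset (Fin k → V × EvenVec D)).val.map
        (color (P.cfi (Pi.single (v, i) 1)) k r) := by
  have hcard : ∀ x : Fin k → V, (univ.image x).card ≤ k + 1 := fun x =>
    (card_image_le.trans (by simp)).trans (Nat.le_succ k)
  choose z hz using fun x : Fin k → V => h.nonempty (univ.image x) (hcard x)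
  have hmove : ∀ x, P.TwistEquiv ∅ (Pi.single (z x, i) 1) (Pi.single (v, i) 1) :=
    fun x => by
      have hzx := h.anti _ _ (empty_subset _) (hz x)
      exact (hv _ hzx).twistEquiv (Set.notMem_empty _) i i
  choose t _ hshift using hmove
  -- The translation applied to a tuple depends on its projection to `V`, which it preserves.
  let f : (Fin k → V × EvenVec D) → (Fin k → V × EvenVec D) := fun u l =>
    ((u l).1, (u l).2 + t (fun l => (u l).1) (u l).1)
  have hf : Function.Involutive f := fun u => by
    funext l
    exact Prod.ext rfl (EvenVec.add_add_cancel _ _)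
  refine map_univ_val_congr hf.toPerm fun u => ?_
  rw [color_cfi_eq h r u _ i (hz _), color_iso (P.gaugeIso (hshift _))]
  rfl

/-- Color refinement gives the same color to all vertices of a fiber, for every twisting. -/
lemma color₁_cfi_eq (P : PortGraph V D) (hD : ∀ j : D, ∃ l, l ≠ j) (r : ℕ)
    (τ τ' : V × D → ZMod 2) (v : V) (a a' : EvenVec D) :
    color₁ (P.cfi τ) r (v, a) = color₁ (P.cfi τ') r (v, a') := by
  classical
  induction r generalizing τ τ' v a a' with
  | zero => rfl
  | succ r ih =>
    have hshift : ∀ w, ∃ s : EvenVec D, ∀ b : EvenVec D,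
        (P.cfi τ).Adj (v, a) (w, b) ↔ (P.cfi τ').Adj (v, a') (w, b + s) := by
      intro w
      by_cases hw : ∃ i, (P.rev (v, i)).1 = w
      · obtain ⟨i, rfl⟩ := hw
        set j := (P.rev (v, i)).2 with hj
        obtain ⟨l, hl⟩ := hD j
        have hs : ∀ c : ZMod 2, ∃ s : EvenVec D, s j = c := by
          intro c
          rcases (by revert c; decide : c = 0 ∨ c = 1) with rfl | rfl
          · exact ⟨0, rfl⟩
          · exact ⟨EvenVec.pair l j, by simp [EvenVec.pair, hl.symm]⟩
        have hadj : ∀ (σ : V × D → ZMod 2) (c b : EvenVec D),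
            (P.cfi σ).Adj (v, c) ((P.rev (v, i)).1, b) ↔
              c i + b j = σ (v, i) + σ (P.rev (v, i)) := by
          intro σ c b
          constructor
          · rintro ⟨i', j', h1, h2⟩
            obtain rfl : i' = i := P.simple v i' i (by rw [h1])
            obtain rfl : j' = j := by rw [hj, h1]
            rw [h1]
            exact h2
          · intro h
            exact ⟨i, j, rfl, h⟩
        obtain ⟨s, hs⟩ := hs (a i + a' i + (τ (v, i) + τ (P.rev (v, i))) +
          (τ' (v, i) + τ' (P.rev (v, i))))
        refine ⟨s, fun b => ?_⟩
        rw [hadj, hadj, EvenVec.coe_add, hs]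
        generalize τ (v, i) + τ (P.rev (v, i)) = x
        generalize τ' (v, i) + τ' (P.rev (v, i)) = y
        generalize a i = a
        generalize a' i = a'
        generalize b j = b
        revert a a' b x y
        decide
      · refine ⟨0, fun b => ⟨?_, ?_⟩⟩ <;> rintro ⟨i, j, h1, _⟩ <;> exact absurd ⟨i, by rw [h1]⟩ hw
    choose s hs using hshift
    exact Prod.ext (ih _ _ _ _ _) (map_filter_val_congr (gaugeEquiv s)
      (fun x => ih _ _ _ _ _) fun x => hs x.1 x.2)

/-- The Cai-Fürer-Immerman graphs are indistinguishable if there is a haven in the component of the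
twisted edge. -/
theorem wlIndistinguishable_cfi {P : PortGraph V D} (hD : ∀ j : D, ∃ l, l ≠ j) {k : ℕ} (v : V)
    (i : D) (h : k ≠ 1 → ∃ h : P.Haven (k + 1), ∀ z ∈ h.side ∅, P.Reach ∅ z v) :
    WLIndistinguishable k (P.cfi 0) (P.cfi (Pi.single (v, i) 1)) := by
  unfold WLIndistinguishable
  split_ifs with hk
  · exact fun r => Multiset.map_congr rfl fun x _ => P.color₁_cfi_eq hD r _ _ x.1 x.2 x.2
  · obtain ⟨h, hv⟩ := h hk
    exact fun r => map_color_cfi_eq h r v i hv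

end WL

end PortGraph

/-! ### Arc-transitivity of the untwisted graph -/

namespace PortGraph

variable {V D : Type*}

/-- The darts `d` and `d'` are related by an automorphism of the graph that permutes the ports in
the same way at all vertices. -/
def DartEquiv (P : PortGraph V D) (d d' : V × D) : Prop :=
  ∃ (σ : V ≃ V) (ρ : D ≃ D),
    (∀ e, P.rev (Prod.map σ ρ e) = Prod.map σ ρ (P.rev e)) ∧ Prod.map σ ρ d = d'

lemma DartEquiv.refl (P : PortGraph V D) (d : V × D) : P.DartEquiv d d :=
  ⟨.refl V, .refl D, fun _ => rfl, rfl⟩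

lemma DartEquiv.symm {P : PortGraph V D} {d d' : V × D} (h : P.DartEquiv d d') :
    P.DartEquiv d' d := by
  obtain ⟨σ, ρ, h, rfl⟩ := h
  have h1 : ∀ x, Prod.map σ ρ (Prod.map σ.symm ρ.symm x) = x := fun x => by simp [Prod.map]
  refine ⟨σ.symm, ρ.symm, fun e => (σ.injective.prodMap ρ.injective) ?_, by simp [Prod.map]⟩
  rw [← h, h1, h1]

lemma DartEquiv.trans {P : PortGraph V D} {d d' d'' : V × D} (h : P.DartEquiv d d')
    (h' : P.DartEquiv d' d'') : P.DartEquiv d d'' := by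
  obtain ⟨σ, ρ, h, rfl⟩ := h
  obtain ⟨σ', ρ', h', rfl⟩ := h'
  refine ⟨σ.trans σ', ρ.trans ρ', fun e => ?_, rfl⟩
  have h2 := h' (Prod.map σ ρ e)
  rwa [h e] at h2

/-- Any two darts are equivalent. -/
def ArcSymmetric (P : PortGraph V D) : Prop := ∀ d d', P.DartEquiv d d'

lemma arcSymmetric_of_dartEquiv {P : PortGraph V D} {d : V × D} (h : ∀ d', P.DartEquiv d d') :
    P.ArcSymmetric := fun _ _ => (h _).symm.trans (h _)

/-- The cycle space of the graph, seen as the space of sets of edges in which all degrees are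
even, is as rich as possible around the edge of `d`: at both ends of it, the intersection with the
set of incident edges can be prescribed, if this is done consistently. -/
def FlexibleAt [Fintype D] (P : PortGraph V D) (d : V × D) : Prop :=
  ∀ a b : EvenVec D, a d.2 = b (P.rev d).2 →
    ∃ t : V → EvenVec D, (∀ e, t (P.rev e).1 (P.rev e).2 = t e.1 e.2) ∧
      t d.1 = a ∧ t (P.rev d).1 = b

/-- The isomorphism of untwisted graphs that is induced by an automorphism of the base graph. -/
def liftIso [Fintype D] (P : PortGraph V D) (σ : V ≃ V) (ρ : D ≃ D)
    (h : ∀ e, P.rev (Prod.map σ ρ e) = Prod.map σ ρ (P.rev e)) : P.cfi 0 ≃g P.cfi 0 where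
  toEquiv := σ.prodCongr (EvenVec.permute ρ)
  map_rel_iff' := by
    rintro ⟨v, a⟩ ⟨w, b⟩
    have key : ∀ i j, P.rev (σ v, ρ i) = (σ w, ρ j) ↔ P.rev (v, i) = (w, j) := by
      intro i j
      have h' := h (v, i)
      rw [Prod.map_apply] at h'
      rw [h', show (σ w, ρ j) = Prod.map σ ρ (w, j) from rfl]
      exact (σ.injective.prodMap ρ.injective).eq_iff
    constructor
    · rintro ⟨i, j, h1, h2⟩
      obtain ⟨i, rfl⟩ := ρ.surjective i
      obtain ⟨j, rfl⟩ := ρ.surjective j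
      refine ⟨i, j, (key i j).1 h1, ?_⟩
      simpa using h2
    · rintro ⟨i, j, h1, h2⟩
      refine ⟨ρ i, ρ j, (key i j).2 h1, ?_⟩
      simpa using h2

/-- An arc of the base graph can be moved everywhere by the automorphisms of the base graph, and
the arcs over a given arc of the base graph are permuted transitively by cycle space elements. -/
theorem arcTransitive_cfi [Fintype D] {P : PortGraph V D} (hs : P.ArcSymmetric) {d : V × D}
    (hd : P.FlexibleAt d) : ArcTransitive (P.cfi 0) := by
  have key : ∀ x y, (P.cfi 0).Adj x y →
      ∃ φ : P.cfi 0 ≃g P.cfi 0, φ x = (d.1, 0) ∧ φ y = ((P.rev d).1, 0) := by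
    rintro ⟨v, a⟩ ⟨w, b⟩ ⟨i, j, h1, h2⟩
    obtain ⟨σ, ρ, hσ, rfl⟩ := hs (v, i) d
    have hr : P.rev (Prod.map σ ρ (v, i)) = (σ w, ρ j) := by
      rw [hσ]
      exact congrArg _ h1
    obtain ⟨t, ht, ha, hb⟩ := hd (EvenVec.permute ρ a) (EvenVec.permute ρ b) (by
      rw [hr]
      simpa [CharTwo.add_eq_zero] using h2)
    have hshift : P.Shifts t 0 0 := fun e => by
      rw [ht e]
      simp [CharTwo.add_self_eq_zero]
    refine ⟨(P.liftIso σ ρ hσ).trans (P.gaugeIso hshift), ?_, ?_⟩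
    · refine Prod.ext rfl ?_
      change EvenVec.permute ρ a + t (Prod.map σ ρ (v, i)).1 = 0
      rw [ha, EvenVec.add_self]
    · rw [hr] at hb ⊢
      refine Prod.ext rfl ?_
      change EvenVec.permute ρ b + t (σ w, ρ j).1 = 0
      rw [hb, EvenVec.add_self]
  intro x y x' y' h h'
  obtain ⟨φ, h1, h2⟩ := key x y h
  obtain ⟨ψ, h3, h4⟩ := key x' y' h'
  exact ⟨φ.trans ψ.symm, by simp [h1, ← h3], by simp [h2, ← h4]⟩

/-! ### Two copies of a graph -/

/-- The disjoint union of two copies of `P`. -/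
def double (P : PortGraph V D) : PortGraph (Bool × V) D where
  rev d := ((d.1.1, (P.rev (d.1.2, d.2)).1), (P.rev (d.1.2, d.2)).2)
  rev_rev d := by simp [P.rev_rev]
  loopless d h := P.loopless (d.1.2, d.2) (congrArg Prod.snd h)
  simple v i j h := P.simple v.2 i j (congrArg Prod.snd h)

lemma ArcSymmetric.double {P : PortGraph V D} (h : P.ArcSymmetric) : P.double.ArcSymmetric := by
  rintro ⟨⟨c, v⟩, i⟩ ⟨⟨c', v'⟩, i'⟩
  obtain ⟨σ, ρ, h1, h2⟩ := h (v, i) (v', i')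
  refine ⟨(Equiv.swap c c').prodCongr σ, ρ, ?_, ?_⟩
  · rintro ⟨⟨e, w⟩, j⟩
    have := h1 (w, j)
    simp only [Prod.map_apply] at this
    simp [PortGraph.double, this]
  · simp only [Prod.map_apply, Prod.mk.injEq] at h2
    simp [h2]

lemma FlexibleAt.double [Fintype D] {P : PortGraph V D} {d : V × D} (h : P.FlexibleAt d) :
    P.double.FlexibleAt ((true, d.1), d.2) := by
  intro a b hab
  obtain ⟨t, h1, h2, h3⟩ := h a b hab
  exact ⟨fun v => t v.2, fun e => h1 (e.1.2, e.2), h2, h3⟩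

lemma Reach.double {P : PortGraph V D} {S : Set V} {T : Set (Bool × V)} {v w : V} {c : Bool}
    (h : P.Reach S v w) (hT : ∀ x, (c, x) ∈ T → x ∈ S) : P.double.Reach T (c, v) (c, w) := by
  refine Relation.ReflTransGen.lift (fun v => (c, v)) ?_ _ _ h
  rintro x y ⟨hx, hy, i, rfl⟩
  exact ⟨fun h => hx (hT _ h), fun h => hy (hT _ h), i, rfl⟩

/-- A haven of `P` gives one of `P.double` that stays in the second copy. -/
def Haven.double [DecidableEq V] {P : PortGraph V D} {s : ℕ} (h : P.Haven s) :
    P.double.Haven s where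
  side S := {v | v.1 = true ∧ v.2 ∈ h.side (S.image Prod.snd)}
  nonempty S hS := by
    obtain ⟨v, hv⟩ := h.nonempty (S.image Prod.snd) (card_image_le.trans hS)
    exact ⟨(true, v), rfl, hv⟩
  notMem S v hv hvS := h.notMem _ _ hv.2 (mem_image_of_mem Prod.snd hvS)
  anti S T hST v hv := ⟨hv.1, h.anti _ _ (image_subset_image hST) hv.2⟩
  reach := by
    rintro S hS ⟨c, v⟩ ⟨rfl : c = true, hv⟩ ⟨c, w⟩ ⟨rfl : c = true, hw⟩
    exact (h.reach _ (card_image_le.trans hS) v hv w hw).double fun x hx =>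
      mem_coe.2 (mem_image_of_mem Prod.snd hx)

/-! ### A single twist destroys arc-transitivity -/

section Twist

variable [Fintype V] [DecidableEq V] [Fintype D] [DecidableEq D]

/-- The parity argument: if exactly one edge is twisted, then there is no consistent choice of a
vertex in each fiber. In the sum over all darts, each even vector contributes `0` and each edge
contributes its twist. -/
lemma no_section (P : PortGraph V D) (d : V × D) (a : V → EvenVec D)
    (h : ∀ e, a e.1 e.2 + a (P.rev e).1 (P.rev e).2 =
      (Pi.single d 1 : V × D → ZMod 2) e + (Pi.single d 1 : V × D → ZMod 2) (P.rev e)) :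
    False := by
  have h1 : ∑ e : V × D, (a e.1 e.2 + (Pi.single d 1 : V × D → ZMod 2) e) = 0 := by
    refine sum_involution (fun e _ => P.rev e) (fun e _ => ?_) (fun e _ _ he => ?_)
      (fun _ _ => mem_univ _) (fun e _ => P.rev_rev e)
    · rw [add_add_add_comm, h, CharTwo.add_self_eq_zero]
    · exact P.loopless e (congrArg Prod.fst he)
  rw [sum_add_distrib, Fintype.sum_prod_type,
    sum_eq_zero fun v _ => EvenVec.sum_eq (a v)] at h1
  simp at h1

/-- In two copies of a connected graph of degree at least two, a twist of one edge of the second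
copy makes the copies distinguishable: there are more homomorphisms from the base graph to the
untwisted copy than to the twisted copy, with a prescribed image of one vertex. Indeed, the
homomorphisms to the twisted copy over a given map of base graphs are, if there are any, as many
as those to the untwisted copy, and over the identity there are none. -/
theorem not_arcTransitive_cfi_double {P : PortGraph V D} (hP : ∀ v w, P.Reach ∅ v w)
    (hD : ∀ j : D, ∃ l, l ≠ j) (v₀ : V) (i₀ : D) :
    ¬ ArcTransitive (P.double.cfi (Pi.single ((true, v₀), i₀) 1)) := by
  classical
  intro hH
  set τ : (Bool × V) × D → ZMod 2 := Pi.single ((true, v₀), i₀) 1 with hτ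
  set H := P.double.cfi τ with hHdef
  have hτf : ∀ v i, τ ((false, v), i) = 0 := fun v i => by simp [hτ]
  -- The roots of both copies have neighbors, so that an automorphism relates them.
  obtain ⟨φ, hφ⟩ : ∃ φ : H ≃g H, φ ((false, v₀), 0) = ((true, v₀), 0) := by
    obtain ⟨i, hi⟩ := hD i₀
    obtain ⟨φ, h, -⟩ := @hH ((false, v₀), 0) ((false, (P.rev (v₀, i)).1), 0)
      ((true, v₀), 0) ((true, (P.rev (v₀, i)).1), 0)
      ⟨i, (P.rev (v₀, i)).2, rfl, by simp [hτf]⟩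
      ⟨i, (P.rev (v₀, i)).2, rfl, by
        have := P.loopless (v₀, i)
        simp [hτ, hi, this]⟩
    exact ⟨φ, h⟩
  let Hom (c : Bool) := {f : P.graph →g H // f v₀ = ((c, v₀), 0)}
  have : ∀ c, Finite (Hom c) := fun c =>
    Finite.of_injective (fun f : Hom c => (f.1 : V → _))
      (DFunLike.coe_injective.comp Subtype.val_injective)
  let e : Hom false ≃ Hom true :=
    { toFun := fun f => ⟨φ.toHom.comp f.1, by
        change φ (f.1 v₀) = _
        rw [f.2, hφ]⟩
      invFun := fun f => ⟨φ.symm.toHom.comp f.1, by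
        change φ.symm (f.1 v₀) = _
        rw [f.2, ← hφ, RelIso.symm_apply_apply]⟩
      left_inv := fun f => Subtype.ext (DFunLike.ext _ _ fun v => φ.symm_apply_apply _)
      right_inv := fun f => Subtype.ext (DFunLike.ext _ _ fun v => φ.apply_symm_apply _) }
  -- Connectedness keeps a homomorphism in the copy of its root.
  have hcopy : ∀ (f : Hom true) v, (f.1 v).1.1 = true := by
    intro f v
    induction hP v₀ v with
    | refl => rw [f.2]
    | @tail x y _ hxy ih =>
      obtain ⟨_, _, hxy⟩ := hxy
      obtain ⟨_, _, h, _⟩ := f.1.map_adj (show P.graph.Adj x y from hxy)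
      exact (congrArg (fun d => d.1.1) h).symm.trans ih
  let base (f : Hom true) : V → V := fun v => (f.1 v).1.2
  -- `s x` is a homomorphism over `x` to the twisted copy, if there is any.
  have hs : ∀ x : V → V, ∃ s : V → EvenVec D, ∀ f : Hom true, base f = x →
      ∃ f' : Hom true, base f' = x ∧ s = fun v => (f'.1 v).2 := by
    intro x
    by_cases hx : ∃ f : Hom true, base f = x
    · obtain ⟨f, hf⟩ := hx
      exact ⟨fun v => (f.1 v).2, fun _ _ => ⟨f, hf, rfl⟩⟩
    · exact ⟨0, fun f hf => absurd ⟨f, hf⟩ hx⟩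
  choose s hs using hs
  have hψ : ∀ f : Hom true, ∃ g : Hom false,
      ∀ v, g.1 v = ((false, base f v), (f.1 v).2 + s (base f) v) := by
    intro f
    obtain ⟨f', hf', hsf'⟩ := hs _ f rfl
    refine ⟨⟨⟨fun v => ((false, base f v), (f.1 v).2 + s (base f) v), ?_⟩, ?_⟩, fun v => rfl⟩
    · intro v w hvw
      obtain ⟨i, j, h1, h2⟩ := f.1.map_adj hvw
      obtain ⟨i', j', h1', h2'⟩ := f'.1.map_adj hvw
      have hb : ∀ v, (f'.1 v).1 = (f.1 v).1 := fun v =>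
        Prod.ext (by rw [hcopy, hcopy]) (congrFun hf' v)
      rw [hb, hb] at h1' h2'
      obtain rfl : i' = i := P.double.simple _ i' i (by rw [h1, h1'])
      obtain rfl : j' = j := by simpa using (h1'.symm.trans h1)
      refine ⟨i', j', ?_, ?_⟩
      · have h3 := congrArg (fun d => d.1.2) h1
        have h4 := congrArg Prod.snd h1
        exact Prod.ext (Prod.ext rfl h3) h4
      · simp only [EvenVec.coe_add, hτf, hsf']
        rw [add_add_add_comm, h2, h2', CharTwo.add_self_eq_zero, add_zero]
    · change ((false, base f v₀), (f.1 v₀).2 + s (base f) v₀) = _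
      simp only [hsf', base, f.2, f'.2, add_zero]
  choose ψ hψ using hψ
  have hinj : Function.Injective ψ := by
    intro f g hfg
    have h1 : ∀ v, ((false, base f v), (f.1 v).2 + s (base f) v) =
        ((false, base g v), (g.1 v).2 + s (base g) v) := fun v => by
      rw [← hψ, ← hψ, hfg]
    have h2 : base f = base g := funext fun v => congrArg (fun x => x.1.2) (h1 v)
    refine Subtype.ext (DFunLike.ext _ _ fun v => ?_)
    refine Prod.ext (Prod.ext (by rw [hcopy, hcopy]) (congrFun h2 v)) ?_
    have h3 := congrArg Prod.snd (h1 v)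
    rw [h2] at h3
    exact add_right_cancel h3
  have hsurj : Function.Surjective ψ := by
    have h := Finite.surjective_of_injective (e.injective.comp hinj)
    exact (EquivLike.comp_surjective ψ e).1 h
  obtain ⟨f, hf⟩ := hsurj ⟨⟨fun v => ((false, v), 0), by
    rintro v w ⟨i, rfl⟩
    exact ⟨i, (P.rev (v, i)).2, rfl, by simp [hτf]⟩⟩, rfl⟩
  have hid : ∀ v, (f.1 v).1 = (true, v) := fun v => by
    refine Prod.ext (hcopy f v) ?_
    have := hψ f v
    rw [hf] at this
    exact (congrArg (fun x => x.1.2) this).symm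
  refine P.no_section (v₀, i₀) (fun v => (f.1 v).2) fun d => ?_
  obtain ⟨i, j, h1, h2⟩ := f.1.map_adj (show P.graph.Adj d.1 (P.rev d).1 from ⟨d.2, rfl⟩)
  rw [hid, hid] at h1 h2
  have h3 : i = d.2 := P.simple d.1 _ _ (congrArg (fun x => x.1.2) h1)
  subst h3
  have h4 : j = (P.rev d).2 := (congrArg Prod.snd h1).symm
  subst h4
  rw [h2]
  simp [hτ, Pi.single_apply, Prod.ext_iff]

end Twist

/-- On two copies of a suitable base graph, the untwisted graph and the graph with a single twist
are as required. -/
theorem exists_pair [Fintype V] [Fintype D] {P : PortGraph V D} {n : ℕ}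
    (hs : P.ArcSymmetric) {d : V × D} (hd : P.FlexibleAt d) (hP : ∀ v w, P.Reach ∅ v w)
    (hD : ∀ j : D, ∃ l, l ≠ j) {K : ℕ → Prop}
    (hK : ∀ k, K k → k ≠ 1 → Nonempty (P.Haven (k + 1)))
    (hn : 2 * Fintype.card V * Fintype.card (EvenVec D) = n) :
    ∃ G H : SimpleGraph (Fin n), ArcTransitive G ∧ ¬ ArcTransitive H ∧
      ∀ k, K k → WLIndistinguishable k G H := by
  classical
  refine exists_on_fin (V := (Bool × V) × EvenVec D) ?_ (P.double.cfi 0)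
    (P.double.cfi (Pi.single ((true, d.1), d.2) 1)) (arcTransitive_cfi hs.double hd.double)
    (not_arcTransitive_cfi_double hP hD d.1 d.2) fun k hk =>
      wlIndistinguishable_cfi hD _ _ fun hk1 => ?_
  · rw [Fintype.card_prod, Fintype.card_prod, Fintype.card_bool, hn]
  · obtain ⟨h⟩ := hK k hk hk1
    refine ⟨h.double, ?_⟩
    rintro ⟨c, v⟩ ⟨rfl : c = true, -⟩
    exact (hP v d.1).double fun x hx => hx

end PortGraph

open PortGraph

/-! ### The toroidal grid -/

namespace Torus

variable {m : ℕ}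

/-- The four directions, in cyclic order. -/
def dir (m : ℕ) : Fin 4 → ZMod m × ZMod m := ![(1, 0), (0, 1), (-1, 0), (0, -1)]

lemma dir_add_two (i : Fin 4) : dir m (i + 2) = -dir m i := by
  fin_cases i <;> simp [dir]

lemma one_ne_zero_of_three_le (hm : 3 ≤ m) : (1 : ZMod m) ≠ 0 := by
  have : Fact (1 < m) := ⟨by omega⟩
  exact one_ne_zero

lemma one_ne_neg_one (hm : 3 ≤ m) : (1 : ZMod m) ≠ -1 := by
  have : Fact (2 < m) := ⟨by omega⟩
  exact (ZMod.neg_one_ne_one).symm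

/-- The `m × m` toroidal grid. -/
def grid (hm : 3 ≤ m) : PortGraph (ZMod m × ZMod m) (Fin 4) where
  rev d := (d.1 + dir m d.2, d.2 + 2)
  rev_rev := by
    rintro ⟨v, i⟩
    refine Prod.ext (by simp [dir_add_two]) ?_
    change i + 2 + 2 = i
    revert i
    decide
  loopless := by
    rintro ⟨v, i⟩ h
    have h1 := one_ne_zero_of_three_le hm
    have h' : dir m i = 0 := by simpa using h
    fin_cases i <;> simp [dir, h1] at h'
  simple := by
    intro v i j h
    have h1 := one_ne_zero_of_three_le hm
    have h2 := one_ne_neg_one hm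
    have h' : dir m i = dir m j := by simpa using h
    fin_cases i <;> fin_cases j <;> simp [dir, h1, h2, h2.symm, h1.symm] at h' ⊢

lemma rev_apply (hm : 3 ≤ m) (v : ZMod m × ZMod m) (i : Fin 4) :
    (grid hm).rev (v, i) = (v + dir m i, i + 2) := rfl

lemma dartEquiv_translate (hm : 3 ≤ m) (v : ZMod m × ZMod m) (i : Fin 4) :
    (grid hm).DartEquiv (0, i) (v, i) := by
  refine ⟨Equiv.addRight v, Equiv.refl _, ?_, by simp⟩
  rintro ⟨w, j⟩
  simp [rev_apply, add_right_comm]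

lemma dartEquiv_rotate (hm : 3 ≤ m) (i : Fin 4) : (grid hm).DartEquiv (0, i) (0, i + 1) := by
  let σ : ZMod m × ZMod m ≃ ZMod m × ZMod m :=
    { toFun := fun v => (-v.2, v.1)
      invFun := fun v => (v.2, -v.1)
      left_inv := fun v => by simp
      right_inv := fun v => by simp }
  refine ⟨σ, Equiv.addRight 1, ?_, by simp [σ]⟩
  rintro ⟨w, j⟩
  fin_cases j <;> simp [rev_apply, dir, σ, add_comm]

lemma arcSymmetric (hm : 3 ≤ m) : (grid hm).ArcSymmetric := by
  refine arcSymmetric_of_dartEquiv (d := (0, 0)) ?_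
  have h0 := dartEquiv_rotate hm 0
  have h1 := h0.trans (dartEquiv_rotate hm 1)
  have h2 := h1.trans (dartEquiv_rotate hm 2)
  rintro ⟨v, i⟩
  refine DartEquiv.trans ?_ (dartEquiv_translate hm v i)
  fin_cases i
  exacts [DartEquiv.refl _ _, h0, h1, h2]

/-- The boundary of a set `F` of unit squares, where a square is named by its lower left corner. -/
def boundary (F : ZMod m → ZMod m → ZMod 2) (v : ZMod m × ZMod m) : EvenVec (Fin 4) :=
  ⟨![F v.1 v.2 + F v.1 (v.2 - 1), F v.1 v.2 + F (v.1 - 1) v.2,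
      F (v.1 - 1) v.2 + F (v.1 - 1) (v.2 - 1), F v.1 (v.2 - 1) + F (v.1 - 1) (v.2 - 1)], by
    change ∑ l, _ = (0 : ZMod 2)
    rw [Fin.sum_univ_four]
    change F v.1 v.2 + F v.1 (v.2 - 1) + (F v.1 v.2 + F (v.1 - 1) v.2) +
      (F (v.1 - 1) v.2 + F (v.1 - 1) (v.2 - 1)) + (F v.1 (v.2 - 1) + F (v.1 - 1) (v.2 - 1)) = 0
    generalize F v.1 v.2 = a
    generalize F v.1 (v.2 - 1) = b
    generalize F (v.1 - 1) v.2 = c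
    generalize F (v.1 - 1) (v.2 - 1) = d
    revert a b c d
    decide⟩

lemma boundary_rev (hm : 3 ≤ m) (F : ZMod m → ZMod m → ZMod 2)
    (e : (ZMod m × ZMod m) × Fin 4) :
    boundary F ((grid hm).rev e).1 ((grid hm).rev e).2 = boundary F e.1 e.2 := by
  obtain ⟨v, i⟩ := e
  fin_cases i <;> simp [rev_apply, boundary, dir, sub_eq_add_neg]

/-- The six squares around an edge suffice to prescribe the boundary at both ends. -/
lemma flexibleAt (hm : 3 ≤ m) : (grid hm).FlexibleAt (0, 0) := by
  intro a b hab
  have h1 := one_ne_zero_of_three_le hm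
  have h2 := one_ne_neg_one hm
  have h0 : (2 : ZMod 2) = 0 := rfl
  have ha := EvenVec.sum_eq a
  have hb := EvenVec.sum_eq b
  rw [Fin.sum_univ_four] at ha hb
  have hab : a 0 = b 2 := hab
  let F : ZMod m → ZMod m → ZMod 2 := fun x y =>
    if y = 0 then if x = -1 then a 1 else if x = 1 then b 1 else 0
    else if x = 0 then a 0 else if x = -1 then a 1 + a 2 else if x = 1 then b 0 + b 1 else 0
  refine ⟨boundary F, boundary_rev hm F, Subtype.ext ?_, Subtype.ext ?_⟩
  · funext i
    fin_cases i <;> simp [boundary, F, h1, h1.symm]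
    · linear_combination a 1 * h0
    · linear_combination ha - a 3 * h0
  · funext i
    fin_cases i <;> simp [boundary, rev_apply, dir, F, h1, h2, h1.symm]
    · linear_combination b 1 * h0
    · exact hab
    · linear_combination hb - b 3 * h0 + hab

lemma reach_row (hm : 3 ≤ m) {S : Set (ZMod m × ZMod m)} {y : ZMod m} (h : ∀ x, (x, y) ∉ S)
    (x x' : ZMod m) : (grid hm).Reach S (x, y) (x', y) := by
  have : NeZero m := ⟨by omega⟩
  have key : ∀ n : ℕ, (grid hm).Reach S (x, y) (x + n, y) := by
    intro n
    induction n with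
    | zero =>
      rw [Nat.cast_zero, add_zero]
      exact .refl
    | succ n ih =>
      exact ih.tail ⟨h _, h _, 0, by simp [rev_apply, dir, add_assoc]⟩
  have h' := key (x' - x).val
  rwa [ZMod.natCast_zmod_val, add_sub_cancel] at h'

lemma reach_column (hm : 3 ≤ m) {S : Set (ZMod m × ZMod m)} {x : ZMod m} (h : ∀ y, (x, y) ∉ S)
    (y y' : ZMod m) : (grid hm).Reach S (x, y) (x, y') := by
  have : NeZero m := ⟨by omega⟩
  have key : ∀ n : ℕ, (grid hm).Reach S (x, y) (x, y + n) := by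
    intro n
    induction n with
    | zero =>
      rw [Nat.cast_zero, add_zero]
      exact .refl
    | succ n ih =>
      exact ih.tail ⟨h _, h _, 1, by simp [rev_apply, dir, add_assoc]⟩
  have h' := key (y' - y).val
  rwa [ZMod.natCast_zmod_val, add_sub_cancel] at h'

lemma reach_all (hm : 3 ≤ m) (v w : ZMod m × ZMod m) : (grid hm).Reach ∅ v w :=
  (reach_row hm (y := v.2) (fun _ => Set.notMem_empty _) v.1 w.1).trans
    (reach_column hm (fun _ => Set.notMem_empty _) v.2 w.2)

lemma exists_notMem_image [NeZero m] {α : Type*} (S : Finset α) (hS : S.card < m)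
    (f : α → ZMod m) : ∃ y, ∀ v ∈ S, f v ≠ y := by
  classical
  have : S.image f ≠ univ := fun h => by
    have h1 := card_image_le (s := S) (f := f)
    rw [h, card_univ, ZMod.card] at h1
    omega
  obtain ⟨y, hy⟩ := not_forall.1 fun h => this (eq_univ_of_forall h)
  exact ⟨y, fun v hv h => hy (mem_image.2 ⟨v, hv, h⟩)⟩

/-- After the removal of fewer than `m` vertices, the rows that remain intact are joined by a
column that remains intact. -/
def haven (hm : 3 ≤ m) {s : ℕ} (hs : s < m) : (grid hm).Haven s where
  side S := {v | ∀ x, (x, v.2) ∉ S}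
  nonempty S hS := by
    have : NeZero m := ⟨by omega⟩
    obtain ⟨y, hy⟩ := exists_notMem_image S (hS.trans_lt hs) Prod.snd
    exact ⟨(0, y), fun x hx => hy _ hx rfl⟩
  notMem S v hv := hv v.1
  anti S T hST v hv x hx := hv x (hST hx)
  reach S hS v hv w hw := by
    have : NeZero m := ⟨by omega⟩
    obtain ⟨x, hx⟩ := exists_notMem_image S (hS.trans_lt hs) Prod.fst
    exact ((reach_row hm hv v.1 x).trans
      (reach_column hm (fun y hy => hx _ hy rfl) v.2 w.2)).trans (reach_row hm hw x w.1)

end Torus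

/-! ### The honeycomb on a torus -/

namespace Honeycomb

variable {p : ℕ}

/-- The sign `1` for the first and `-1` for the second class of the bipartition. -/
def sign (p : ℕ) (c : Bool) : ZMod p := cond c (-1) 1

@[simp] lemma sign_false : sign p false = 1 := rfl

@[simp] lemma sign_true : sign p true = -1 := rfl

@[simp] lemma sign_not (c : Bool) : sign p (!c) = -sign p c := by
  cases c <;> simp

/-- The three directions. -/
def dir (ω : ZMod p) : Fin 3 → ZMod p := ![1, ω, ω ^ 2]

lemma cube_eq_one {ω : ZMod p} (hω : ω ^ 2 + ω + 1 = 0) : ω ^ 3 = 1 := by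
  linear_combination (ω - 1) * hω

lemma ne_one {ω : ZMod p} (hω : ω ^ 2 + ω + 1 = 0) (h3 : (3 : ZMod p) ≠ 0) : ω ≠ 1 := by
  rintro rfl
  exact h3 (by linear_combination hω)

lemma sq_ne_one {ω : ZMod p} (hω : ω ^ 2 + ω + 1 = 0) (h3 : (3 : ZMod p) ≠ 0) :
    ω ^ 2 ≠ 1 := by
  intro h
  refine ne_one hω h3 ?_
  linear_combination cube_eq_one hω - ω * h

lemma sq_ne_self {ω : ZMod p} (hω : ω ^ 2 + ω + 1 = 0) (h3 : (3 : ZMod p) ≠ 0) :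
    ω ^ 2 ≠ ω := by
  intro h
  refine sq_ne_one hω h3 ?_
  linear_combination cube_eq_one hω - ω * h

lemma mul_dir {ω : ZMod p} (hω : ω ^ 2 + ω + 1 = 0) (i : Fin 3) :
    ω * dir ω i = dir ω (i + 1) := by
  have := cube_eq_one hω
  fin_cases i <;> simp [dir]
  · ring
  · rw [← this]
    ring

/-- The honeycomb. The vertices of both classes are the elements of `ℤ/p`, where `ω` stands for a
primitive cube root of unity, and `x` in the first class is adjacent to `x + 1`, `x + ω` and
`x + ω²` in the second. This is the quotient of the honeycomb in the complex plane by an ideal of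
norm `p` of the ring of Eisenstein integers. -/
def honeycomb (ω : ZMod p) (hω : ω ^ 2 + ω + 1 = 0) (h3 : (3 : ZMod p) ≠ 0) :
    PortGraph (Bool × ZMod p) (Fin 3) where
  rev d := ((!d.1.1, d.1.2 + sign p d.1.1 * dir ω d.2), d.2)
  rev_rev := by
    rintro ⟨⟨c, x⟩, i⟩
    simp
  loopless := by
    rintro ⟨⟨c, x⟩, i⟩ h
    simpa using congrArg Prod.fst h
  simple := by
    rintro ⟨c, x⟩ i j h
    have h1 := ne_one hω h3
    have h2 := sq_ne_one hω h3
    have h4 := sq_ne_self hω h3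
    have h' : dir ω i = dir ω j := by
      cases c <;> simpa using h
    fin_cases i <;> fin_cases j <;>
      simp [dir, h1, h2, h4, h1.symm, h2.symm, h4.symm] at h' ⊢

section

variable {ω : ZMod p} (hω : ω ^ 2 + ω + 1 = 0) (h3 : (3 : ZMod p) ≠ 0)

lemma rev_apply (c : Bool) (x : ZMod p) (i : Fin 3) :
    (honeycomb ω hω h3).rev ((c, x), i) = ((!c, x + sign p c * dir ω i), i) := rfl

lemma dartEquiv_translate (c : Bool) (x : ZMod p) (i : Fin 3) :
    (honeycomb ω hω h3).DartEquiv ((c, 0), i) ((c, x), i) := by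
  refine ⟨(Equiv.refl _).prodCongr (Equiv.addRight x), Equiv.refl _, ?_, by simp⟩
  rintro ⟨⟨d, y⟩, j⟩
  simp [rev_apply, add_right_comm]

lemma dartEquiv_rotate (c : Bool) (i : Fin 3) :
    (honeycomb ω hω h3).DartEquiv ((c, 0), i) ((c, 0), i + 1) := by
  have h1 := cube_eq_one hω
  let σ : ZMod p ≃ ZMod p :=
    { toFun := fun x => ω * x
      invFun := fun x => ω ^ 2 * x
      left_inv := fun x => by linear_combination x * h1
      right_inv := fun x => by linear_combination x * h1 }
  refine ⟨(Equiv.refl _).prodCongr σ, Equiv.addRight 1, ?_, by simp [σ]⟩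
  rintro ⟨⟨d, y⟩, j⟩
  simp [rev_apply, σ, ← mul_dir hω, mul_add, mul_left_comm]

lemma dartEquiv_swap (i : Fin 3) :
    (honeycomb ω hω h3).DartEquiv ((false, 0), i) ((true, 0), i) := by
  refine ⟨Equiv.boolNot.prodCongr (Equiv.neg _), Equiv.refl _, ?_, by simp⟩
  rintro ⟨⟨d, y⟩, j⟩
  simp [rev_apply, add_comm]

lemma arcSymmetric : (honeycomb ω hω h3).ArcSymmetric := by
  refine arcSymmetric_of_dartEquiv (d := ((false, 0), 0)) ?_
  have h0 := dartEquiv_rotate hω h3 false 0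
  have h1 := h0.trans (dartEquiv_rotate hω h3 false 1)
  rintro ⟨⟨c, x⟩, i⟩
  refine DartEquiv.trans (d' := ((false, 0), i)) ?_
    (DartEquiv.trans ?_ (dartEquiv_translate hω h3 c x i))
  · fin_cases i
    exacts [DartEquiv.refl _ _, h0, h1]
  · cases c
    exacts [DartEquiv.refl _ _, dartEquiv_swap hω h3 i]

/-- The boundary of a set `F` of hexagons. The center of a hexagon is an element of `ℤ/p` as well;
the hexagon that is opposite to port `i` of `x` is named `x - ω ^ i` if `x` is in the first class,
and `x + ω ^ i` otherwise. -/
def boundary (ω : ZMod p) (F : ZMod p → ZMod 2) (v : Bool × ZMod p) : EvenVec (Fin 3) :=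
  let f i := F (v.2 - sign p v.1 * dir ω i)
  ⟨![f 1 + f 2, f 0 + f 2, f 0 + f 1], by
    change ∑ l, _ = (0 : ZMod 2)
    rw [Fin.sum_univ_three]
    change f 1 + f 2 + (f 0 + f 2) + (f 0 + f 1) = 0
    have h0 : (2 : ZMod 2) = 0 := rfl
    linear_combination (f 0 + f 1 + f 2) * h0⟩

lemma boundary_rev (F : ZMod p → ZMod 2) (e : (Bool × ZMod p) × Fin 3) :
    boundary ω F ((honeycomb ω hω h3).rev e).1 ((honeycomb ω hω h3).rev e).2 =
      boundary ω F e.1 e.2 := by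
  obtain ⟨⟨c, x⟩, i⟩ := e
  set s := sign p c with hs
  have h01 : x + s * 1 - -s * ω = x - s * ω ^ 2 := by linear_combination s * hω
  have h02 : x + s * 1 - -s * ω ^ 2 = x - s * ω := by linear_combination s * hω
  have h10 : x + s * ω - -s * 1 = x - s * ω ^ 2 := by linear_combination s * hω
  have h12 : x + s * ω - -s * ω ^ 2 = x - s * 1 := by linear_combination s * hω
  have h20 : x + s * ω ^ 2 - -s * 1 = x - s * ω := by linear_combination s * hω
  have h21 : x + s * ω ^ 2 - -s * ω = x - s * 1 := by linear_combination s * hω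
  fin_cases i
  · change F (x + s * 1 - sign p (!c) * ω) + F (x + s * 1 - sign p (!c) * ω ^ 2) =
      F (x - s * ω) + F (x - s * ω ^ 2)
    rw [sign_not, ← hs, h01, h02, add_comm]
  · change F (x + s * ω - sign p (!c) * 1) + F (x + s * ω - sign p (!c) * ω ^ 2) =
      F (x - s * 1) + F (x - s * ω ^ 2)
    rw [sign_not, ← hs, h10, h12, add_comm]
  · change F (x + s * ω ^ 2 - sign p (!c) * 1) + F (x + s * ω ^ 2 - sign p (!c) * ω) =
      F (x - s * 1) + F (x - s * ω)
    rw [sign_not, ← hs, h20, h21, add_comm]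

/-- The four hexagons around an edge suffice to prescribe the boundary at both ends. -/
lemma flexibleAt : (honeycomb ω hω h3).FlexibleAt ((false, 0), 0) := by
  intro a b hab
  have h0 : (2 : ZMod 2) = 0 := rfl
  have ha := EvenVec.sum_eq a
  have hb := EvenVec.sum_eq b
  rw [Fin.sum_univ_three] at ha hb
  have hab : a 0 = b 0 := hab
  have n1 : -ω ^ 2 ≠ -1 := fun h => sq_ne_one hω h3 (neg_injective h)
  have n2 : (2 : ZMod p) ≠ -1 := fun h => h3 (by linear_combination h)
  have n3 : -ω ≠ -1 := fun h => ne_one hω h3 (neg_injective h)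
  have n4 : -ω ≠ -ω ^ 2 := fun h => sq_ne_self hω h3 (neg_injective h).symm
  have n5 : (2 : ZMod p) ≠ -ω ^ 2 := fun h => ne_one hω h3 (by linear_combination hω - h)
  have n6 : -ω ≠ 2 := fun h => h3 (by linear_combination hω + (ω - 1) * h)
  let F : ZMod p → ZMod 2 := fun x =>
    if x = -1 then a 0 + a 1 else if x = -ω ^ 2 then a 0 else if x = 2 then b 1 else 0
  have F0 : F (-1) = a 0 + a 1 := if_pos rfl
  have F1 : F (-ω) = 0 := by simp only [F, if_neg n3, if_neg n4, if_neg n6]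
  have F2 : F (-ω ^ 2) = a 0 := by simp only [F, if_neg n1, if_pos]
  have F3 : F 2 = b 1 := by simp only [F, if_neg n2, if_neg n5, if_pos]
  have e1 : 1 + ω = -ω ^ 2 := by linear_combination hω
  have e2 : 1 + ω ^ 2 = -ω := by linear_combination hω
  have e3 : (1 : ZMod p) + 1 = 2 := by norm_num
  refine ⟨boundary ω F, boundary_rev hω h3 F, Subtype.ext ?_, Subtype.ext ?_⟩
  · funext i
    fin_cases i <;> simp [boundary, dir, F0, F1, F2]
    · linear_combination a 0 * h0
    · linear_combination ha - a 2 * h0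
  · funext i
    fin_cases i <;> simp [boundary, rev_apply, dir, e1, e2, e3, F1, F2, F3]
    · exact hab
    · linear_combination hb - b 2 * h0 + hab

/-! ### Short walks in the honeycomb -/

/-- The translation of the first class that results from steps along the ports `i` and `j`, for all
pairs `(i, j)` in the list `l`. -/
def displacement (ω : ZMod p) (l : List (Fin 3 × Fin 3)) : ZMod p :=
  (l.map fun s => dir ω s.1 - dir ω s.2).sum

lemma displacement_append (l l' : List (Fin 3 × Fin 3)) :
    displacement ω (l ++ l') = displacement ω l + displacement ω l' := by
  simp [displacement]

lemma displacement_replicate (n : ℕ) (s : Fin 3 × Fin 3) :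
    displacement ω (List.replicate n s) = n * (dir ω s.1 - dir ω s.2) := by
  simp [displacement]

lemma displacement_swap (l : List (Fin 3 × Fin 3)) :
    displacement ω (l.map Prod.swap) = -displacement ω l := by
  induction l with
  | nil => simp [displacement]
  | cons s l ih =>
    simp only [displacement, List.map_cons, List.sum_cons, Prod.fst_swap, Prod.snd_swap] at ih ⊢
    rw [ih]
    ring

/-- If `S` is a set of removed vertices, then few walks with given steps meet `S`. -/
lemma exists_card_le_reach (S : Finset (Bool × ZMod p)) (l : List (Fin 3 × Fin 3)) :
    ∃ B : Finset (ZMod p), B.card ≤ S.card * (l.length + 1) ∧ ∀ x ∉ B, (false, x) ∉ S ∧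
      (honeycomb ω hω h3).Reach S (false, x) (false, x + displacement ω l) := by
  classical
  induction l with
  | nil =>
    refine ⟨S.image Prod.snd, card_image_le.trans (by simp), fun x hx => ⟨fun h => ?_, ?_⟩⟩
    · exact hx (mem_image_of_mem Prod.snd h)
    · rw [displacement, List.map_nil, List.sum_nil, add_zero]
      exact .refl
  | cons s l ih =>
    obtain ⟨B, hB, h⟩ := ih
    refine ⟨S.image (fun v => cond v.1 (v.2 - dir ω s.1) v.2) ∪
      B.image (fun x => x - (dir ω s.1 - dir ω s.2)), ?_, fun x hx => ?_⟩
    · refine (card_union_le _ _).trans ((add_le_add card_image_le card_image_le).trans ?_)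
      rw [List.length_cons]
      linarith
    · rw [mem_union, not_or] at hx
      have h1 : (false, x) ∉ S := fun h => hx.1 (mem_image.2 ⟨_, h, rfl⟩)
      have h2 : (true, x + dir ω s.1) ∉ S := fun h => hx.1 (mem_image.2 ⟨_, h, by simp⟩)
      obtain ⟨h4, h5⟩ := h (x + (dir ω s.1 - dir ω s.2)) fun h =>
        hx.2 (mem_image.2 ⟨_, h, by simp⟩)
      refine ⟨h1, ?_⟩
      have h6 : x + displacement ω (s :: l) =
          x + (dir ω s.1 - dir ω s.2) + displacement ω l := by
        simp [displacement, add_assoc]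
      rw [h6]
      refine .head ⟨h1, h2, s.1, by simp [rev_apply]⟩ (.head ⟨h2, h4, s.2, ?_⟩ h5)
      simp [rev_apply, sub_eq_add_neg, add_assoc]

end

lemma exists_displacement_nat {ω : ZMod p} (a b : ℕ) :
    (∃ l, 3 * (l.length : ℤ) ^ 2 ≤ 4 * ((a : ℤ) ^ 2 - a * b + b ^ 2) ∧
      displacement ω l = (1 - ω) * (a + b * ω)) ∧
    (∃ l, 3 * (l.length : ℤ) ^ 2 ≤ 4 * ((a : ℤ) ^ 2 + a * b + b ^ 2) ∧
      displacement ω l = (1 - ω) * (a - b * ω)) := by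
  refine ⟨?_, List.replicate a (0, 1) ++ List.replicate b (2, 1), ?_, ?_⟩
  · rcases le_total a b with h | h
    · obtain ⟨c, rfl⟩ := Nat.exists_eq_add_of_le h
      refine ⟨List.replicate a (0, 2) ++ List.replicate c (1, 2), ?_, ?_⟩
      · simp only [List.length_append, List.length_replicate]
        push_cast
        nlinarith [sq_nonneg ((a : ℤ) - c)]
      · rw [displacement_append, displacement_replicate, displacement_replicate]
        simp [dir]
        ring
    · obtain ⟨c, rfl⟩ := Nat.exists_eq_add_of_le h
      refine ⟨List.replicate b (0, 2) ++ List.replicate c (0, 1), ?_, ?_⟩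
      · simp only [List.length_append, List.length_replicate]
        push_cast
        nlinarith [sq_nonneg ((b : ℤ) - c)]
      · rw [displacement_append, displacement_replicate, displacement_replicate]
        simp [dir]
        ring
  · simp only [List.length_append, List.length_replicate]
    push_cast
    nlinarith [sq_nonneg ((a : ℤ) - b)]
  · rw [displacement_append, displacement_replicate, displacement_replicate]
    simp [dir]
    ring

/-- The length of a shortest walk is bounded in terms of the norm of the Eisenstein integer. -/
lemma exists_displacement {ω : ZMod p} (a b : ℤ) :
    ∃ l, 3 * (l.length : ℤ) ^ 2 ≤ 4 * (a ^ 2 - a * b + b ^ 2) ∧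
      displacement ω l = (1 - ω) * (a + b * ω) := by
  obtain ⟨a, rfl | rfl⟩ := a.eq_nat_or_neg <;> obtain ⟨b, rfl | rfl⟩ := b.eq_nat_or_neg
  · simpa using (exists_displacement_nat a b).1
  · obtain ⟨l, h1, h2⟩ := (exists_displacement_nat (ω := ω) a b).2
    refine ⟨l, by linarith, by rw [h2]; push_cast; ring⟩
  · obtain ⟨l, h1, h2⟩ := (exists_displacement_nat (ω := ω) a b).2
    refine ⟨l.map Prod.swap, by rw [List.length_map]; linarith, ?_⟩
    rw [displacement_swap, h2]
    push_cast
    ring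
  · obtain ⟨l, h1, h2⟩ := (exists_displacement_nat (ω := ω) a b).1
    refine ⟨l.map Prod.swap, by rw [List.length_map]; linarith, ?_⟩
    rw [displacement_swap, h2]
    push_cast
    ring

section

variable [Fact p.Prime] {ω : ZMod p}

/-- By Thue's pigeonhole argument there is an Eisenstein integer of norm `p` that vanishes modulo
`p` when `ω` is substituted. -/
lemma exists_norm_eq (hω : ω ^ 2 + ω + 1 = 0) (hp2 : p ≠ 2) :
    ∃ c d : ℤ, (c + d * ω : ZMod p) = 0 ∧ c ^ 2 - c * d + d ^ 2 = p := by
  have hp : p.Prime := Fact.out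
  set q := Nat.sqrt p with hq
  have hq1 : q * q ≤ p := Nat.sqrt_le p
  have hq2 : p < (q + 1) * (q + 1) := Nat.lt_succ_sqrt p
  obtain ⟨⟨x, y⟩, ⟨x', y'⟩, hne, heq⟩ := Fintype.exists_ne_map_eq_of_card_lt
    (fun v : Fin (q + 1) × Fin (q + 1) => ((v.1 : ℕ) + (v.2 : ℕ) * ω : ZMod p))
    (by simpa [ZMod.card] using hq2)
  simp only at heq
  set c : ℤ := (x : ℕ) - (x' : ℕ) with hc
  set d : ℤ := (y : ℕ) - (y' : ℕ) with hd
  have h0 : (c + d * ω : ZMod p) = 0 := by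
    rw [hc, hd]
    push_cast
    linear_combination heq
  have hcd : c ≠ 0 ∨ d ≠ 0 := by
    by_contra! h
    refine hne (Prod.ext (Fin.ext ?_) (Fin.ext ?_)) <;> simp only <;> omega
  have hcq : c ^ 2 ≤ q ^ 2 := sq_le_sq' (by omega) (by omega)
  have hdq : d ^ 2 ≤ q ^ 2 := sq_le_sq' (by omega) (by omega)
  have hqp : (q : ℤ) ^ 2 < p := by
    refine lt_of_le_of_ne (by rw [sq]; exact_mod_cast hq1) fun h => ?_
    have h' : q ^ 2 = p := by exact_mod_cast h
    exact hp.not_isSquare ⟨q, by rw [← h', sq]⟩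
  have hpos : 0 < c ^ 2 - c * d + d ^ 2 := by
    rcases hcd with h | h
    · nlinarith [sq_nonneg (2 * d - c), pow_pos (abs_pos.2 h) 2, sq_abs c]
    · nlinarith [sq_nonneg (2 * c - d), pow_pos (abs_pos.2 h) 2, sq_abs d]
  have hlt : c ^ 2 - c * d + d ^ 2 < 3 * p := by nlinarith [sq_nonneg (c + d)]
  have hdvd : (p : ℤ) ∣ c ^ 2 - c * d + d ^ 2 := by
    rw [← ZMod.intCast_zmod_eq_zero_iff_dvd]
    push_cast
    linear_combination (c + d * ω ^ 2) * h0 - (c : ZMod p) * d * hω -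
      (d : ZMod p) ^ 2 * cube_eq_one hω
  obtain ⟨n, hn⟩ := hdvd
  have hp0 : (0 : ℤ) < p := by exact_mod_cast hp.pos
  have hn1 : 0 < n := by
    rw [hn] at hpos
    exact (pos_iff_pos_of_mul_pos hpos).1 hp0
  have hn2 : n < 3 := by
    rw [hn] at hlt
    nlinarith
  refine ⟨c, d, h0, ?_⟩
  obtain rfl | rfl : n = 1 ∨ n = 2 := by omega
  · rw [hn, mul_one]
  · -- A norm is not congruent to `2` modulo `4`.
    exfalso
    have hodd : p % 2 = 1 := hp.eq_two_or_odd.resolve_left hp2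
    rcases Int.even_or_odd' c with ⟨c', h1 | h1⟩ <;> rcases Int.even_or_odd' d with ⟨d', h2 | h2⟩ <;>
      rw [h1, h2] at hn <;> ring_nf at hn <;> omega

/-- Every residue is represented by an Eisenstein integer of norm at most `3p / 4`, which is obtained
by reduction modulo an Eisenstein integer of norm `p`. -/
lemma exists_small (hω : ω ^ 2 + ω + 1 = 0) (hp2 : p ≠ 2) (x : ZMod p) :
    ∃ a b : ℤ, (a + b * ω : ZMod p) = x ∧ 4 * (a ^ 2 - a * b + b ^ 2) ≤ 3 * p := by
  have hp : p.Prime := Fact.out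
  obtain ⟨c, d, h0, hN⟩ := exists_norm_eq hω hp2
  have hp0 : (0 : ℤ) < p := by exact_mod_cast hp.pos
  have hround : ∀ y : ℤ, ∃ s : ℤ, |2 * (y - p * s)| ≤ p := fun y => by
    refine ⟨(2 * y + p) / (2 * p), ?_⟩
    have h1 := Int.emod_add_mul_ediv (2 * y + p) (2 * p)
    have h2 := Int.emod_nonneg (2 * y + p) (by positivity : (2 * p : ℤ) ≠ 0)
    have h3 := Int.emod_lt_of_pos (2 * y + p) (by positivity : (0 : ℤ) < 2 * p)
    rw [abs_le]
    constructor <;> linarith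
  set z : ℤ := (x.val : ℤ) with hz
  obtain ⟨s, hs⟩ := hround (z * (c - d))
  obtain ⟨t, ht⟩ := hround (-z * d)
  have hxz : (z : ZMod p) = x := by
    rw [hz, Int.cast_natCast, ZMod.natCast_zmod_val]
  refine ⟨z - s * c + t * d, -(s * d + t * c - t * d), ?_, ?_⟩
  · push_cast
    rw [hxz]
    linear_combination (-(s : ZMod p) - t * ω) * h0 + (t : ZMod p) * d * hω
  · set u := z * (c - d) - p * s with hu
    set v := -z * d - p * t with hv
    have h1 : (p : ℤ) * ((z - s * c + t * d) ^ 2 -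
        (z - s * c + t * d) * -(s * d + t * c - t * d) + (-(s * d + t * c - t * d)) ^ 2) =
        u ^ 2 - u * v + v ^ 2 := by
      rw [hu, hv, ← hN]
      ring
    have hu2 := abs_le.1 hs
    have hv2 := abs_le.1 ht
    have h2 : 4 * (u ^ 2 - u * v + v ^ 2) ≤ 3 * p * p := by
      nlinarith [mul_nonneg (sub_nonneg.2 hu2.1) (sub_nonneg.2 hu2.2)]
    nlinarith

lemma exists_short (hω : ω ^ 2 + ω + 1 = 0) (h3 : (3 : ZMod p) ≠ 0)
    (hp2 : p ≠ 2) (g : ZMod p) :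
    ∃ l, l.length ≤ Nat.sqrt p ∧ displacement ω l = g := by
  have hω1 : 1 - ω ≠ 0 := sub_ne_zero.2 (ne_one hω h3).symm
  obtain ⟨a, b, hab, hN⟩ := exists_small hω hp2 ((1 - ω)⁻¹ * g)
  obtain ⟨l, hl, hd⟩ := exists_displacement (ω := ω) a b
  refine ⟨l, ?_, by rw [hd, hab, mul_inv_cancel_left₀ hω1]⟩
  rw [Nat.le_sqrt']
  have : (l.length : ℤ) ^ 2 ≤ p := by linarith
  exact_mod_cast this

variable (hω : ω ^ 2 + ω + 1 = 0) (h3 : (3 : ZMod p) ≠ 0)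

lemma reach_first (hp2 : p ≠ 2) (x y : ZMod p) :
    (honeycomb ω hω h3).Reach ∅ (false, x) (false, y) := by
  obtain ⟨l, -, hl⟩ := exists_short hω h3 hp2 (y - x)
  obtain ⟨B, hB, h⟩ := exists_card_le_reach hω h3 ∅ l
  have hB : B = ∅ := by simpa using hB
  subst hB
  have := (h x (notMem_empty _)).2
  rw [hl, add_sub_cancel] at this
  simpa using this

lemma reach_all (hp2 : p ≠ 2) (v w : Bool × ZMod p) :
    (honeycomb ω hω h3).Reach ∅ v w := by
  have h1 : ∀ v : Bool × ZMod p, ∃ x, (honeycomb ω hω h3).Reach ∅ v (false, x) := by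
    rintro ⟨c, x⟩
    cases c
    · exact ⟨x, .refl⟩
    · exact ⟨x - 1, .single ⟨Set.notMem_empty _, Set.notMem_empty _, 0, by
        simp [rev_apply, dir, sub_eq_add_neg]⟩⟩
  obtain ⟨x, hx⟩ := h1 v
  obtain ⟨y, hy⟩ := h1 w
  exact (hx.trans (reach_first hω h3 hp2 x y)).trans hy.symm

/-- After the removal of a set `S` of few vertices, some vertex still reaches more than half of the
first class: on average over all pairs, a short walk between its members does not meet `S`. -/
lemma exists_majority (hp2 : p ≠ 2) {S : Finset (Bool × ZMod p)}
    (hS : 2 * (S.card * (Nat.sqrt p + 1)) < p) :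
    ∃ x, (false, x) ∉ S ∧
      p < 2 * {y | (honeycomb ω hω h3).Reach S (false, x) (false, y)}.ncard := by
  classical
  choose l hl hd using exists_short hω h3 hp2
  choose B hB h using fun g => exists_card_le_reach hω h3 S (l g)
  -- The shift `g` is blocked at `x` if `x ∈ B g`.
  obtain ⟨x, hx⟩ : ∃ x, 2 * (univ.filter fun g => x ∈ B g).card < p := by
    by_contra! hcon
    have h1 : ∑ x : ZMod p, (univ.filter fun g => x ∈ B g).card = ∑ g, (B g).card := by
      simp only [card_filter]
      rw [sum_comm]
      refine sum_congr rfl fun g _ => ?_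
      rw [← card_filter, filter_univ_mem]
    have h2 : ∑ g, (B g).card ≤ p * (S.card * (Nat.sqrt p + 1)) := by
      refine (sum_le_card_nsmul univ _ (S.card * (Nat.sqrt p + 1)) fun g _ => (hB g).trans ?_).trans
        (by rw [card_univ, ZMod.card, smul_eq_mul])
      exact Nat.mul_le_mul_left _ (Nat.succ_le_succ (hl g))
    have h3 : p * p ≤ ∑ x : ZMod p, 2 * (univ.filter fun g => x ∈ B g).card := by
      have := card_nsmul_le_sum univ (fun x : ZMod p => 2 * (univ.filter fun g => x ∈ B g).card) p
        fun x _ => hcon x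
      rwa [card_univ, ZMod.card, smul_eq_mul] at this
    rw [← mul_sum, h1] at h3
    have hp : 0 < p := Nat.Prime.pos Fact.out
    nlinarith
  have hcard : (univ.filter fun g => x ∈ B g).card + (univ.filter fun g => x ∉ B g).card = p := by
    rw [card_filter_add_card_filter_not, card_univ, ZMod.card]
  refine ⟨x, ?_, ?_⟩
  · have : 0 < (univ.filter fun g => x ∉ B g).card := by omega
    obtain ⟨g, hg⟩ := card_pos.1 this
    exact (h g x (mem_filter.1 hg).2).1
  · have h1 : (((univ.filter fun g => x ∉ B g).image (x + ·) : Finset (ZMod p)) : Set (ZMod p)) ⊆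
        {y | (honeycomb ω hω h3).Reach S (false, x) (false, y)} := by
      intro y hy
      obtain ⟨g, hg, rfl⟩ := mem_image.1 (mem_coe.1 hy)
      have h4 := (h g x (mem_filter.1 hg).2).2
      rwa [hd] at h4
    have h2 := Set.ncard_le_ncard h1 (Set.toFinite _)
    rw [Set.ncard_coe_finset, card_image_of_injective _ (add_right_injective x)] at h2
    omega

/-- The haven that always selects the connected component with more than half of the first
class. -/
def haven (hp2 : p ≠ 2) {s : ℕ} (hs : 2 * (s * (Nat.sqrt p + 1)) < p) :
    (honeycomb ω hω h3).Haven s where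
  side S := {v | v ∉ S ∧ p < 2 * {y | (honeycomb ω hω h3).Reach S v (false, y)}.ncard}
  nonempty S hS := by
    have h1 := Nat.mul_le_mul_right (Nat.sqrt p + 1) hS
    obtain ⟨x, hx⟩ := exists_majority hω h3 hp2 (S := S) (by omega)
    exact ⟨_, hx⟩
  notMem S v hv := hv.1
  anti S T hST v hv := by
    refine ⟨fun h => hv.1 (hST h), hv.2.trans_le (Nat.mul_le_mul_left 2 ?_)⟩
    exact Set.ncard_le_ncard (fun y hy => Reach.mono (coe_subset.2 hST) hy) (Set.toFinite _)
  reach S _ v hv w hw := by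
    by_contra hvw
    have hdisj : Disjoint {y | (honeycomb ω hω h3).Reach S v (false, y)}
        {y | (honeycomb ω hω h3).Reach S w (false, y)} :=
      Set.disjoint_left.2 fun y hy hy' => hvw (Relation.ReflTransGen.trans hy (Reach.symm hy'))
    have h1 := Set.ncard_union_eq hdisj (Set.toFinite _) (Set.toFinite _)
    have h2 := Set.ncard_le_card
      ({y | (honeycomb ω hω h3).Reach S v (false, y)} ∪
        {y | (honeycomb ω hω h3).Reach S w (false, y)})
    rw [Nat.card_eq_fintype_card, ZMod.card] at h2
    have := hv.2
    have := hw.2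
    omega

end

lemma exists_root [Fact p.Prime] (hp : p ≡ 1 [MOD 3]) : ∃ ω : ZMod p, ω ^ 2 + ω + 1 = 0 := by
  have hp1 : p.Prime := Fact.out
  have : Fact (Nat.Prime 3) := ⟨Nat.prime_three⟩
  have hdvd : 3 ∣ Fintype.card (ZMod p)ˣ := by
    rw [ZMod.card_units]
    exact (Nat.modEq_iff_dvd' hp1.one_le).1 hp.symm
  obtain ⟨u, hu⟩ := exists_prime_orderOf_dvd_card 3 hdvd
  have h1 : (u : ZMod p) ^ 3 = 1 := by
    rw [← Units.val_pow_eq_pow_val, ← hu, pow_orderOf_eq_one, Units.val_one]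
  have h2 : (u : ZMod p) ≠ 1 := by
    rw [Ne, Units.val_eq_one]
    rintro rfl
    simp at hu
  refine ⟨u, (mul_eq_zero.1 ?_).resolve_left (sub_ne_zero.2 h2)⟩
  linear_combination h1

end Honeycomb

/-! ### Complete graphs, and complete graphs without one edge -/

lemma arcTransitive_top (V : Type*) : ArcTransitive (⊤ : SimpleGraph V) := by
  classical
  intro u v u' v' h h'
  have h1 : Equiv.swap u u' v ≠ u' := fun h2 =>
    h.ne' ((Equiv.swap u u').injective (h2.trans (Equiv.swap_apply_left u u').symm))
  refine ⟨⟨(Equiv.swap u u').trans (Equiv.swap (Equiv.swap u u' v) v'), by simp⟩, ?_, ?_⟩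
  · change Equiv.swap (Equiv.swap u u' v) v' (Equiv.swap u u' u) = u'
    rw [Equiv.swap_apply_left]
    exact Equiv.swap_apply_of_ne_of_ne h1.symm h'.ne
  · exact Equiv.swap_apply_left _ _

/-- A complete graph without one edge is not arc-transitive, since it has vertices of different
positive degrees. -/
lemma not_arcTransitive_of_unique_nonedge {V : Type*} {H : SimpleGraph V} {x y z : V}
    (hxy : x ≠ y) (hxyH : ¬ H.Adj x y) (hzx : H.Adj z x) (hz : ∀ w, w ≠ z → H.Adj z w) :
    ¬ ArcTransitive H := by
  intro h
  obtain ⟨φ, h1, -⟩ := h hzx hzx.symm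
  refine hxyH ?_
  rw [← h1, ← φ.apply_symm_apply y]
  refine φ.map_adj_iff.2 (hz _ fun h2 => hxy ?_)
  rw [← h1, ← h2, φ.apply_symm_apply]

/-- If there is no `k` to be considered, then any arc-transitive graph and any graph that is not
arc-transitive will do. -/
lemma exists_pair_of_forall_not {n : ℕ} (hn : 3 ≤ n) {K : ℕ → Prop} (hK : ∀ k, ¬ K k) :
    ∃ G H : SimpleGraph (Fin n), ArcTransitive G ∧ ¬ ArcTransitive H ∧
      ∀ k, K k → WLIndistinguishable k G H := by
  let x : Fin n := ⟨0, by omega⟩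
  let y : Fin n := ⟨1, by omega⟩
  let z : Fin n := ⟨2, by omega⟩
  have hzx : z ≠ x := by simp [z, x]
  have hzy : z ≠ y := by simp [z, y]
  have hz : ∀ w, w ≠ z → ((⊤ : SimpleGraph (Fin n)).deleteEdges {s(x, y)}).Adj z w :=
    fun w hw => by simp [hw.symm, hzx, hzy]
  exact ⟨⊤, (⊤ : SimpleGraph (Fin n)).deleteEdges {s(x, y)}, arcTransitive_top _,
    not_arcTransitive_of_unique_nonedge (x := x) (y := y) (by simp [x, y]) (by simp)
      (hz x hzx.symm) hz, fun k hk => absurd hk (hK k)⟩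

end WLArc

theorem theorem4 :
    (∀ n : ℕ, 0 < n → IsSquare n → 16 ∣ n →
      ∃ G H : SimpleGraph (Fin n),
        WLArc.ArcTransitive G ∧ ¬ WLArc.ArcTransitive H ∧
        ∀ k : ℕ, 1 ≤ k → (k : ℝ) ≤ 0.05 * Real.sqrt (n : ℝ) →
          WLArc.WLIndistinguishable k G H) ∧
    (∀ n p : ℕ, p.Prime → p ≡ 1 [MOD 3] → n = 16 * p →
      ∃ G H : SimpleGraph (Fin n),
        WLArc.ArcTransitive G ∧ ¬ WLArc.ArcTransitive H ∧
        ∀ k : ℕ, 1 ≤ k → (k : ℝ) ≤ 0.06 * Real.sqrt (n : ℝ) →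
          WLArc.WLIndistinguishable k G H) := by
  constructor
  · rintro n hn ⟨r, rfl⟩ h16
    obtain ⟨m, rfl⟩ : 4 ∣ r := by
      rw [← sq, show 16 = 4 ^ 2 from rfl] at h16
      exact (Nat.pow_dvd_pow_iff two_ne_zero).1 h16
    have hm : 0 < m := by
      rcases m.eq_zero_or_pos with rfl | h
      · simp at hn
      · exact h
    have hsqrt : √((4 * m * (4 * m) : ℕ) : ℝ) = 4 * m := by
      rw [Nat.cast_mul, Real.sqrt_mul_self (Nat.cast_nonneg _)]
      push_cast
      rfl
    rw [hsqrt]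
    simp only [← and_imp]
    by_cases hm3 : m < 3
    -- Here the grid is not a simple graph of degree four, but there is no `k` to be considered.
    · refine WLArc.exists_pair_of_forall_not (by nlinarith) fun k hk => ?_
      have h1 : (1 : ℝ) ≤ k := by exact_mod_cast hk.1
      have h2 : (m : ℝ) ≤ 3 := by exact_mod_cast hm3.le
      linarith [hk.2]
    · have hm3 : 3 ≤ m := by omega
      have : NeZero m := ⟨by omega⟩
      refine WLArc.PortGraph.exists_pair (WLArc.Torus.arcSymmetric hm3)
        (WLArc.Torus.flexibleAt hm3) (WLArc.Torus.reach_all hm3) (by decide)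
        (fun k hk _ => ⟨WLArc.Torus.haven hm3 ?_⟩) ?_
      · have h1 : (1 : ℝ) ≤ k := by exact_mod_cast hk.1
        have h3 : ((k + 1 : ℕ) : ℝ) < m := by
          push_cast
          linarith [hk.2]
        exact_mod_cast h3
      · rw [Fintype.card_prod, ZMod.card, WLArc.EvenVec.card_fin_succ]
        ring
  · rintro n p hp hp3 rfl
    have : Fact p.Prime := ⟨hp⟩
    obtain ⟨ω, hω⟩ := WLArc.Honeycomb.exists_root hp3
    have hp2 : p ≠ 2 := by
      rintro rfl
      exact absurd hp3 (by decide)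
    have h3 : (3 : ZMod p) ≠ 0 := by
      intro h
      have h' : p ∣ 3 := (ZMod.natCast_eq_zero_iff 3 p).1 (by exact_mod_cast h)
      rcases (Nat.prime_dvd_prime_iff_eq hp Nat.prime_three).1 h' with rfl
      exact absurd hp3 (by decide)
    simp only [← and_imp]
    refine WLArc.PortGraph.exists_pair (WLArc.Honeycomb.arcSymmetric hω h3)
      (WLArc.Honeycomb.flexibleAt hω h3) (WLArc.Honeycomb.reach_all hω h3 hp2) (by decide)
      (fun k hk hk1 => ⟨WLArc.Honeycomb.haven hω h3 hp2 ?_⟩) ?_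
    · have hsqrt : √((16 * p : ℕ) : ℝ) = 4 * √p := by
        rw [Nat.cast_mul, Real.sqrt_mul (Nat.cast_nonneg _)]
        congr 1
        rw [show ((16 : ℕ) : ℝ) = 4 ^ 2 by norm_num, Real.sqrt_sq (by norm_num)]
      have h2 : (2 : ℝ) ≤ k := by
        have : 2 ≤ k := by omega
        exact_mod_cast this
      have h4 := hk.2
      rw [hsqrt] at h4
      have h5 : (Nat.sqrt p : ℝ) ≤ √p := Real.nat_sqrt_le_real_sqrt
      have h6 : √(p : ℝ) * √p = p := Real.mul_self_sqrt (Nat.cast_nonneg _)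
      have h7 : ((k : ℝ) + 1) * (Nat.sqrt p + 1) ≤ (0.24 * √p + 1) * (√p + 1) := by
        gcongr
        linarith
      have h8 : (2 * ((k + 1) * (Nat.sqrt p + 1)) : ℝ) < p := by nlinarith
      exact_mod_cast h8
    · rw [Fintype.card_prod, Fintype.card_bool, ZMod.card, WLArc.EvenVec.card_fin_succ]
      ring
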